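/- Let $K$ be a field and let $A$ be a $K$-algebra that is a (not necessarily commutative) domain. Let $\alpha$ be a $K$-automorphism of $A$, let $u\in Z(A)$ be central, and put $v=u-\alpha(u)$. Let $R=R(A,\alpha,v,1)$ be the conformal ambiskew polynomial algebra, that is, the iterated skew polynomial algebra $A[y;\alpha][x;\beta,\delta]$, where $\beta$ extends $\alpha^{-1}$ by $\beta(y)=y$ and $\delta$ is the $\beta$-derivation with $\delta(A)=0$ and $\delta(y)=v$; thus $ya=\alpha(a)y$ and $xa=\alpha^{-1}(a)x$ for $a\in A$, and $xy=yx+v$. Let $z=xy-u$ be its (central) Casimir element. Assume that the skew Laurent polynomial ring $A[y^{\pm1};\alpha]$ is simple and that its centre is $K$. Let $\lambda\in K$ and let $m\ge 1$ be an integer such that $M:=(u+\lambda)A+\alpha^m(u+\lambda)A\neq A$ and $(u+\lambda)A+\alpha^n(u+\lambda)A=A$ for all integers $n\ge 1$ with $n\ne m$. (i) If $M$ is a maximal (two-sided) ideal of $A$, then the ring $R/(z-\lambda)R$ has a unique non-zero prime ideal. (ii) If the factor ring $A/M$ is a simple right Ore domain, then $R/(z-\lambda)R$ has a unique non-zero prime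 ideal $P/(z-\lambda)R$, and $R/P$ has right Goldie rank $m$. Here an ideal $P$ of a ring is prime if it is proper and $IJ\subseteq P$ implies $I\subseteq P$ or $J\subseteq P$ for all two-sided ideals $I,J$; a ring has right Goldie rank $m$ if, as a right module over itself, it has an essential submodule that is a direct sum of $m$ uniform submodules. -/

import Mathlib

/-- A left `σ`-derivation of a ring `B`: an additive map `δ` with `δ(ab) = σ(a)δ(b) + δ(a)b`. -/
structure SkewDerivation {B : Type*} [Ring B] (σ : B →+* B) where
  toFun : B →+ B
  leibniz : ∀ a b : B, toFun (a * b) = σ a * toFun b + toFun a * b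

/-- The skew polynomial ring (Ore extension) `B[X; σ, δ]`: its elements are the finite sums
`∑ bₙ Xⁿ` (coefficients on the left), and `X b = σ(b) X + δ(b)`. -/
def OreExtension {B : Type*} [Ring B] (σ : B →+* B) (_δ : SkewDerivation σ) := ℕ →₀ B

namespace OreExtension

variable {B : Type*} [Ring B] {σ : B →+* B} {δ : SkewDerivation σ}

noncomputable instance : AddCommGroup (OreExtension σ δ) :=
  inferInstanceAs (AddCommGroup (ℕ →₀ B))

noncomputable instance : Module B (OreExtension σ δ) :=
  inferInstanceAs (Module B (ℕ →₀ B))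

/-- The element `b Xⁿ`. -/
noncomputable def monomial (n : ℕ) : B →ₗ[B] OreExtension σ δ :=
  Finsupp.lsingle (M := B) n

@[elab_as_elim]
theorem induct {p : OreExtension σ δ → Prop} (f : OreExtension σ δ) (h0 : p 0)
    (hadd : ∀ f g, p f → p g → p (f + g)) (hmon : ∀ n b, p (monomial n b)) : p f :=
  Finsupp.induction_linear f h0 hadd hmon

/-- Extension of a family of additive maps on coefficients to an additive map. -/
noncomputable def sumHom {N : Type*} [AddCommGroup N] (F : ℕ → B →+ N) :
    OreExtension σ δ →+ N :=
  Finsupp.liftAddHom (M := B) F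

@[simp]
theorem sumHom_monomial {N : Type*} [AddCommGroup N] (F : ℕ → B →+ N) (n : ℕ) (b : B) :
    sumHom F (monomial n b : OreExtension σ δ) = F n b :=
  Finsupp.liftAddHom_apply_single (M := B) F n b

/-- Left multiplication by `X`: `X · b Xⁿ = σ(b) Xⁿ⁺¹ + δ(b) Xⁿ`. -/
noncomputable def mulX : OreExtension σ δ →+ OreExtension σ δ :=
  sumHom fun n => (monomial (n + 1)).toAddMonoidHom.comp σ.toAddMonoidHom +
    (monomial n).toAddMonoidHom.comp δ.toFun

theorem mulX_monomial (n : ℕ) (b : B) :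
    mulX (monomial n b : OreExtension σ δ) = monomial (n + 1) (σ b) + monomial n (δ.toFun b) := by
  simp [mulX]

theorem mulX_smul (b : B) (f : OreExtension σ δ) :
    mulX (b • f) = σ b • mulX f + δ.toFun b • f := by
  induction f using induct with
  | h0 => simp
  | hadd f g hf hg => rw [smul_add, map_add, hf, hg, map_add, smul_add, smul_add]; abel
  | hmon n c =>
    rw [← map_smul, mulX_monomial, mulX_monomial]
    simp only [smul_eq_mul, map_mul, δ.leibniz, map_add, smul_add, ← map_smul]
    abel

/-- Multiplication: `(∑ bᵢ Xⁱ) · g = ∑ bᵢ (X · (X · ⋯ (X · g)))`. -/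
noncomputable def mulHom (g : OreExtension σ δ) : OreExtension σ δ →+ OreExtension σ δ :=
  sumHom fun n => (smulAddHom B (OreExtension σ δ)).flip (mulX^[n] g)

noncomputable instance : Mul (OreExtension σ δ) := ⟨fun f g => mulHom g f⟩

noncomputable instance : One (OreExtension σ δ) := ⟨monomial 0 1⟩

theorem one_def : (1 : OreExtension σ δ) = monomial 0 1 := rfl

theorem monomial_mul (n : ℕ) (b : B) (g : OreExtension σ δ) :
    monomial n b * g = b • mulX^[n] g := by
  change mulHom g (monomial n b) = _
  simp [mulHom]

theorem add_mul' (f g h : OreExtension σ δ) : (f + g) * h = f * h + g * h :=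
  map_add (mulHom h) f g

theorem zero_mul' (h : OreExtension σ δ) : 0 * h = 0 :=
  map_zero (mulHom h)

theorem mul_add' (f g h : OreExtension σ δ) : f * (g + h) = f * g + f * h := by
  induction f using induct with
  | h0 => simp [zero_mul']
  | hadd a b ha hb => rw [add_mul', ha, hb, add_mul', add_mul']; abel
  | hmon n b => simp [monomial_mul, iterate_map_add]

theorem mul_zero' (f : OreExtension σ δ) : f * 0 = 0 := by
  induction f using induct with
  | h0 => exact zero_mul' 0
  | hadd a b ha hb => rw [add_mul', ha, hb, add_zero]
  | hmon n b => simp [monomial_mul, iterate_map_zero]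

theorem one_mul' (f : OreExtension σ δ) : 1 * f = f := by
  simp [one_def, monomial_mul]

theorem smul_mul' (b : B) (f g : OreExtension σ δ) : (b • f) * g = b • (f * g) := by
  induction f using induct with
  | h0 => simp [zero_mul']
  | hadd f h hf hh => rw [smul_add, add_mul', hf, hh, add_mul', smul_add]
  | hmon n c => rw [← map_smul, monomial_mul, monomial_mul, smul_smul, smul_eq_mul]

theorem mulX_mul (f g : OreExtension σ δ) : mulX f * g = mulX (f * g) := by
  induction f using induct with
  | h0 => simp [zero_mul']
  | hadd f h hf hh => rw [map_add, add_mul', hf, hh, add_mul', map_add]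
  | hmon n c =>
    rw [mulX_monomial, add_mul', monomial_mul, monomial_mul, monomial_mul, mulX_smul,
      Function.iterate_succ_apply']

theorem iterate_mulX_mul (n : ℕ) (f g : OreExtension σ δ) :
    mulX^[n] f * g = mulX^[n] (f * g) := by
  induction n with
  | zero => rfl
  | succ n ih => rw [Function.iterate_succ_apply', mulX_mul, ih, Function.iterate_succ_apply']

theorem mul_assoc' (f g h : OreExtension σ δ) : f * g * h = f * (g * h) := by
  induction f using induct with
  | h0 => simp [zero_mul']
  | hadd a b ha hb => rw [add_mul', add_mul', add_mul', ha, hb]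
  | hmon n b => rw [monomial_mul, smul_mul', iterate_mulX_mul, monomial_mul]

theorem iterate_mulX_one (n : ℕ) : mulX^[n] (1 : OreExtension σ δ) = monomial n 1 := by
  induction n with
  | zero => rfl
  | succ n ih =>
    have hd : δ.toFun 1 = 0 := by simpa using δ.leibniz 1 1
    rw [Function.iterate_succ_apply', ih, mulX_monomial, hd]
    simp

theorem mul_one' (f : OreExtension σ δ) : f * 1 = f := by
  induction f using induct with
  | h0 => exact zero_mul' 1
  | hadd a b ha hb => rw [add_mul', ha, hb]
  | hmon n b => rw [monomial_mul, iterate_mulX_one, ← map_smul]; simp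

noncomputable instance : Ring (OreExtension σ δ) :=
  { (inferInstance : AddCommGroup (OreExtension σ δ)) with
    mul := (· * ·)
    one := 1
    mul_assoc := mul_assoc'
    one_mul := one_mul'
    mul_one := mul_one'
    left_distrib := mul_add'
    right_distrib := add_mul'
    zero_mul := zero_mul'
    mul_zero := mul_zero' }

/-- The inclusion `B → B[X; σ, δ]`. -/
noncomputable def C : B →+* OreExtension σ δ where
  toFun := monomial 0
  map_one' := rfl
  map_zero' := map_zero _
  map_add' := map_add _
  map_mul' a b := by rw [monomial_mul, Function.iterate_zero, id, ← map_smul, smul_eq_mul]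

/-- The indeterminate. -/
noncomputable def X : OreExtension σ δ := monomial 1 1

theorem X_mul_C (b : B) : (X : OreExtension σ δ) * C b = C (σ b) * X + C (δ.toFun b) := by
  simp [X, C, monomial_mul, mulX_monomial, ← map_smul]

theorem monomial_eq (n : ℕ) (b : B) : (monomial n b : OreExtension σ δ) = C b * X ^ n := by
  have h : ∀ n : ℕ, (X : OreExtension σ δ) ^ n = monomial n 1 := by
    intro n
    induction n with
    | zero => rfl
    | succ n ih =>
      rw [pow_succ', ih, X, monomial_mul, one_smul, Function.iterate_one, ← iterate_mulX_one,
        ← Function.iterate_succ_apply' (f := mulX), iterate_mulX_one]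
  rw [h, C, RingHom.coe_mk, MonoidHom.coe_mk, OneHom.coe_mk, monomial_mul, Function.iterate_zero,
    id, ← map_smul, smul_eq_mul, mul_one]

/-- The universal property of `B[X; σ, δ]`. -/
noncomputable def lift {S : Type*} [Ring S] (f : B →+* S) (s : S)
    (h : ∀ b, s * f b = f (σ b) * s + f (δ.toFun b)) : OreExtension σ δ →+* S :=
  have key : ∀ g : OreExtension σ δ,
      sumHom (fun n => (AddMonoidHom.mulRight (s ^ n)).comp f.toAddMonoidHom) (mulX g) =
      s * sumHom (fun n => (AddMonoidHom.mulRight (s ^ n)).comp f.toAddMonoidHom) g := by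
    intro g
    induction g using induct with
    | h0 => simp
    | hadd a b ha hb => rw [map_add, map_add, ha, hb, map_add, mul_add]
    | hmon n b => simp [mulX_monomial, ← mul_assoc, h, add_mul, pow_succ']
  have key2 : ∀ (b : B) (g : OreExtension σ δ),
      sumHom (fun n => (AddMonoidHom.mulRight (s ^ n)).comp f.toAddMonoidHom) (b • g) =
      f b * sumHom (fun n => (AddMonoidHom.mulRight (s ^ n)).comp f.toAddMonoidHom) g := by
    intro b g
    induction g using induct with
    | h0 => simp
    | hadd a b ha hb => rw [smul_add, map_add, ha, hb, map_add, mul_add]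
    | hmon n b => rw [← map_smul]; simp [mul_assoc]
  { toFun := sumHom fun n => (AddMonoidHom.mulRight (s ^ n)).comp f.toAddMonoidHom
    map_zero' := map_zero _
    map_add' := map_add _
    map_one' := by simp [one_def]
    map_mul' := by
      have key3 : ∀ (n : ℕ) (g : OreExtension σ δ),
          sumHom (fun n => (AddMonoidHom.mulRight (s ^ n)).comp f.toAddMonoidHom) (mulX^[n] g) =
          s ^ n * sumHom (fun n => (AddMonoidHom.mulRight (s ^ n)).comp f.toAddMonoidHom) g := by
        intro n g
        induction n with
        | zero => simp
        | succ n ih => rw [Function.iterate_succ_apply', key, ih, pow_succ', mul_assoc]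
      intro p g
      induction p using induct with
      | h0 => simp
      | hadd a b ha hb => rw [add_mul, map_add, ha, hb, map_add, add_mul]
      | hmon n b => rw [monomial_mul, key2, key3]; simp [mul_assoc] }

@[simp]
theorem lift_C {S : Type*} [Ring S] (f : B →+* S) (s : S)
    (h : ∀ b, s * f b = f (σ b) * s + f (δ.toFun b)) (b : B) :
    lift f s h (C b : OreExtension σ δ) = f b := by
  change sumHom (σ := σ) (δ := δ) _ (monomial 0 b) = _
  simp

@[simp]
theorem lift_X {S : Type*} [Ring S] (f : B →+* S) (s : S)
    (h : ∀ b, s * f b = f (σ b) * s + f (δ.toFun b)) :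
    lift f s h (X : OreExtension σ δ) = s := by
  change sumHom (σ := σ) (δ := δ) _ (monomial 1 1) = _
  simp

@[ext]
theorem ringHom_ext {S : Type*} [Ring S] {f g : OreExtension σ δ →+* S}
    (hC : ∀ b, f (C b) = g (C b)) (hX : f X = g X) : f = g := by
  ext p
  induction p using induct with
  | h0 => simp
  | hadd a b ha hb => rw [map_add, map_add, ha, hb]
  | hmon n b => rw [monomial_eq, map_mul, map_mul, map_pow, map_pow, hC, hX]

end OreExtension

section Ambiskew

variable {K A : Type*} [Field K] [Ring A] [Algebra K A]

/-- The skew polynomial ring `A[y; α]` of automorphism type, in which `y a = α(a) y`. -/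
abbrev SkewPoly (α : A ≃ₐ[K] A) :=
  OreExtension (B := A) (α : A →+* A) ⟨0, by simp⟩

namespace SkewPoly

variable (α : A ≃ₐ[K] A)

theorem X_mul_C (a : A) :
    (OreExtension.X : SkewPoly α) * OreExtension.C a = OreExtension.C (α a) * OreExtension.X := by
  rw [OreExtension.X_mul_C]; simp

/-- The ring endomorphism of `A[y; α]` with `a ↦ α⁻¹(a)` for `a ∈ A` and `y ↦ ρ y`, which
extends `β = α⁻¹`. -/
noncomputable def beta (ρ : K) : SkewPoly α →+* SkewPoly α :=
  OreExtension.lift ((OreExtension.C).comp (α.symm : A →+* A))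
    (OreExtension.C (algebraMap K A ρ) * OreExtension.X) (by
      intro a
      have h := X_mul_C α (α.symm a)
      simp only [AlgEquiv.apply_symm_apply] at h
      simp [mul_assoc, h]
      simp only [← mul_assoc, ← map_mul, Algebra.commutes])

@[simp]
theorem beta_C (ρ : K) (a : A) :
    beta α ρ (OreExtension.C a) = OreExtension.C (α.symm a) := by
  simp [beta]

@[simp]
theorem beta_X (ρ : K) :
    beta α ρ OreExtension.X = OreExtension.C (algebraMap K A ρ) * OreExtension.X := by
  simp [beta]

/-- The ring homomorphism `f ↦ !![β(f), δ(f); 0, f]`, whose upper right entry is the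
`β`-derivation `δ` with `δ(A) = 0` and `δ(y) = v`. -/
noncomputable def deltaMatrix (ρ : K) (v : Subalgebra.center K A) :
    SkewPoly α →+* Matrix (Fin 2) (Fin 2) (SkewPoly α) :=
  OreExtension.lift
    { toFun := fun a => !![OreExtension.C (α.symm a), 0; 0, OreExtension.C a]
      map_one' := by ext i j; fin_cases i <;> fin_cases j <;> simp
      map_zero' := by ext i j; fin_cases i <;> fin_cases j <;> simp
      map_add' := fun a b => by ext i j; fin_cases i <;> fin_cases j <;> simp
      map_mul' := fun a b => by ext i j; fin_cases i <;> fin_cases j <;> simp }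
    !![OreExtension.C (algebraMap K A ρ) * OreExtension.X, OreExtension.C (v : A);
      0, OreExtension.X] (by
      intro a
      have h := X_mul_C α (α.symm a)
      simp only [AlgEquiv.apply_symm_apply] at h
      have hv : (v : A) * a = a * v := (Subalgebra.mem_center_iff.1 v.2 a).symm
      ext i j
      fin_cases i <;> fin_cases j <;> simp [mul_assoc, h, X_mul_C]
      · simp only [← mul_assoc, ← map_mul, Algebra.commutes]
      · simp only [← map_mul, hv])

theorem deltaMatrix_apply (ρ : K) (v : Subalgebra.center K A) (f : SkewPoly α) :
    deltaMatrix α ρ v f 0 0 = beta α ρ f ∧ deltaMatrix α ρ v f 1 0 = 0 ∧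
      deltaMatrix α ρ v f 1 1 = f := by
  induction f using OreExtension.induct with
  | h0 => simp
  | hadd f g hf hg => simp [hf, hg]
  | hmon n b =>
    have hC : deltaMatrix α ρ v (OreExtension.C b) =
      !![OreExtension.C (α.symm b), 0; 0, OreExtension.C b] := by simp [deltaMatrix]
    have hX : deltaMatrix α ρ v OreExtension.X =
      !![OreExtension.C (algebraMap K A ρ) * OreExtension.X, OreExtension.C (v : A);
        0, OreExtension.X] := by simp [deltaMatrix]
    rw [OreExtension.monomial_eq]
    induction n with
    | zero => simp [hC]
    | succ n ih =>
      obtain ⟨h1, h2, h3⟩ := ih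
      rw [pow_succ, ← mul_assoc, map_mul (deltaMatrix α ρ v), map_mul (beta α ρ), hX]
      generalize deltaMatrix α ρ v (OreExtension.C b * OreExtension.X ^ n) = N at h1 h2 h3
      simp [Matrix.mul_apply, h1, h2, h3]

/-- The `β`-derivation `δ` of `A[y; α]` with `δ(A) = 0` and `δ(y) = v`. -/
noncomputable def delta (ρ : K) (v : Subalgebra.center K A) : SkewDerivation (beta α ρ) where
  toFun :=
    { toFun := fun f => deltaMatrix α ρ v f 0 1
      map_zero' := by simp
      map_add' := fun f g => by simp }
  leibniz f g := by
    obtain ⟨h1, -, -⟩ := deltaMatrix_apply α ρ v f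
    obtain ⟨-, -, h2⟩ := deltaMatrix_apply α ρ v g
    simp [Matrix.mul_apply, h1, h2]

@[simp]
theorem delta_C (ρ : K) (v : Subalgebra.center K A) (a : A) :
    (delta α ρ v).toFun (OreExtension.C a) = 0 := by
  simp [delta, deltaMatrix]

@[simp]
theorem delta_X (ρ : K) (v : Subalgebra.center K A) :
    (delta α ρ v).toFun OreExtension.X = OreExtension.C (v : A) := by
  simp [delta, deltaMatrix]

end SkewPoly

/-- The ambiskew polynomial algebra `R(A, α, v, ρ) = A[y; α][x; β, δ]`, for `v` central in `A` and
a scalar `ρ` (usually nonzero; we need `ρ = 1`). -/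
abbrev Ambiskew (α : A ≃ₐ[K] A) (v : Subalgebra.center K A) (ρ : K) :=
  OreExtension (B := SkewPoly α) (SkewPoly.beta α ρ) (SkewPoly.delta α ρ v)

namespace Ambiskew

/-- The central element `u - ρ α(u)`, for `u` central. -/
def split (α : A ≃ₐ[K] A) (u : Subalgebra.center K A) (ρ : K) : Subalgebra.center K A :=
  ⟨u - ρ • α u, by
    refine sub_mem u.2 (Subalgebra.smul_mem _ (Subalgebra.mem_center_iff.2 fun b => ?_) _)
    have h := congrArg α (Subalgebra.mem_center_iff.1 u.2 (α.symm b))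
    simpa using h⟩

variable {α : A ≃ₐ[K] A} {v : Subalgebra.center K A} {ρ : K}

/-- The inclusion `A → R(A, α, v, ρ)`. -/
noncomputable def ofBase : A →+* Ambiskew α v ρ := OreExtension.C.comp OreExtension.C

/-- The generator `y`. -/
noncomputable def y : Ambiskew α v ρ := OreExtension.C OreExtension.X

/-- The generator `x`. -/
noncomputable def x : Ambiskew α v ρ := OreExtension.X

theorem y_mul_ofBase (a : A) : (y : Ambiskew α v ρ) * ofBase a = ofBase (α a) * y := by
  simp only [y, ofBase, RingHom.comp_apply, ← map_mul, SkewPoly.X_mul_C]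

theorem x_mul_ofBase (a : A) : (x : Ambiskew α v ρ) * ofBase a = ofBase (α.symm a) * x := by
  simp only [x, ofBase, RingHom.comp_apply, OreExtension.X_mul_C]
  simp

theorem x_mul_y : (x : Ambiskew α v ρ) * y = ofBase (algebraMap K A ρ) * y * x + ofBase (v : A) := by
  simp only [x, y, ofBase, RingHom.comp_apply, OreExtension.X_mul_C]
  simp

/-- The Casimir element `z = xy - u` of the conformal algebra `R(A, α, u - ρ α(u), ρ)`. -/
noncomputable def casimir (α : A ≃ₐ[K] A) (u : Subalgebra.center K A) (ρ : K) :
    Ambiskew α (split α u ρ) ρ :=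
  x * y - ofBase (u : A)

end Ambiskew

/-- The skew Laurent polynomial ring `A[y^{±1}; α]`, in which `y a = α(a) y`; it is the skew
group ring of `ℤ` over `A`, with `n` acting as `αⁿ`. -/
def SkewLaurent (_α : A ≃ₐ[K] A) := SkewMonoidAlgebra A (Multiplicative ℤ)

namespace SkewLaurent

/-- The action of `ℤ` on `A` in which `n` acts as `αⁿ`. -/
abbrev action (α : A ≃ₐ[K] A) : MulSemiringAction (Multiplicative ℤ) A :=
  MulSemiringAction.compHom A (zpowersHom (A ≃ₐ[K] A) α)

noncomputable instance (α : A ≃ₐ[K] A) : Ring (SkewLaurent α) :=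
  letI := action α
  inferInstanceAs (Ring (SkewMonoidAlgebra A (Multiplicative ℤ)))

/-- The element `a yⁿ`. -/
noncomputable def single (α : A ≃ₐ[K] A) (n : ℤ) (a : A) : SkewLaurent α :=
  SkewMonoidAlgebra.single (Multiplicative.ofAdd n) a

theorem single_mul_single (α : A ≃ₐ[K] A) (n k : ℤ) (a b : A) :
    single α n a * single α k b = single α (n + k) (a * (α ^ n) b) := by
  let _ := action α
  exact SkewMonoidAlgebra.single_mul_single

@[elab_as_elim]
theorem induct {α : A ≃ₐ[K] A} {p : SkewLaurent α → Prop} (f : SkewLaurent α)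
    (hsingle : ∀ n a, p (single α n a)) (hadd : ∀ f g, p f → p g → p (f + g)) : p f :=
  SkewMonoidAlgebra.induction_on' (p := p) f (fun n a => hsingle n.toAdd a) hadd

/-- The algebra structure over `K ⊆ A ⊆ A[y^{±1}; α]`. -/
noncomputable instance (α : A ≃ₐ[K] A) : Algebra K (SkewLaurent α) :=
  RingHom.toAlgebra'
    { toFun := fun c => single α 0 (algebraMap K A c)
      map_one' := by rw [map_one]; rfl
      map_zero' := by rw [map_zero]; exact SkewMonoidAlgebra.single_zero _
      map_add' := fun a b => by rw [map_add]; exact SkewMonoidAlgebra.single_add _ _ _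
      map_mul' := fun a b => by rw [single_mul_single]; simp }
    (by
      intro c f
      induction f using induct with
      | hsingle n a => simp [single_mul_single, Algebra.commutes]
      | hadd f g hf hg =>
        simp only [RingHom.coe_mk, MonoidHom.coe_mk, OneHom.coe_mk] at hf hg ⊢
        rw [mul_add, add_mul, hf, hg])

end SkewLaurent

end Ambiskew

namespace TwoSidedIdeal

variable {S : Type*} [Ring S]

/-- The factor ring `S/I`. -/
abbrev FactorRing (I : TwoSidedIdeal S) : Type _ := I.ringCon.Quotient

/-- The canonical epimorphism `S → S/I`. -/
abbrev toFactor (I : TwoSidedIdeal S) : S →+* I.FactorRing := I.ringCon.mk'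

/-- An ideal `P` is prime if it is proper and, for all ideals `I`, `J` with `IJ ⊆ P`, one has
`I ⊆ P` or `J ⊆ P`. -/
def IsPrimeIdeal (P : TwoSidedIdeal S) : Prop :=
  P ≠ ⊤ ∧ ∀ I J : TwoSidedIdeal S, (∀ a ∈ I, ∀ b ∈ J, a * b ∈ P) → I ≤ P ∨ J ≤ P

/-- For `c` central, the ideal generated by `c` is `cS`. -/
theorem mem_span_singleton_of_central {c : S} (hc : ∀ s, s * c = c * s) (a : S) :
    a ∈ span {c} ↔ ∃ s, a = c * s := by
  constructor
  · intro h
    let I : TwoSidedIdeal S := .mk' {a | ∃ s, a = c * s} ⟨0, by simp⟩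
      (by rintro _ _ ⟨s, rfl⟩ ⟨t, rfl⟩; exact ⟨s + t, by rw [mul_add]⟩)
      (by rintro _ ⟨s, rfl⟩; exact ⟨-s, by simp⟩)
      (by rintro r _ ⟨s, rfl⟩; exact ⟨r * s, by rw [← mul_assoc, hc, mul_assoc]⟩)
      (by rintro _ r ⟨s, rfl⟩; exact ⟨s * r, by rw [mul_assoc]⟩)
    have hI : span {c} ≤ I := span_le.2 (by
      rintro _ rfl
      exact (mem_mk' ..).2 ⟨1, by simp⟩)
    simpa [I] using hI h
  · rintro ⟨s, rfl⟩
    exact mul_mem_right _ _ _ (subset_span rfl)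

end TwoSidedIdeal

/-- `U` is a uniform submodule: it is nonzero and any two of its nonzero submodules have nonzero
intersection. -/
def Submodule.IsUniform {S M : Type*} [Ring S] [AddCommGroup M] [Module S M]
    (U : Submodule S M) : Prop :=
  U ≠ ⊥ ∧ ∀ V W : Submodule S M, V ≤ U → W ≤ U → V ≠ ⊥ → W ≠ ⊥ → V ⊓ W ≠ ⊥

/-- The module `M` has Goldie rank (uniform dimension) `n`: some direct sum of `n` uniform
submodules is essential in `M`, that is, meets every nonzero submodule. (Such `n` is unique.) -/
def HasGoldieRank (S M : Type*) [Ring S] [AddCommGroup M] [Module S M] (n : ℕ) : Prop :=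
  ∃ U : Fin n → Submodule S M, (∀ i, (U i).IsUniform) ∧ iSupIndep U ∧
    ∀ V : Submodule S M, V ≠ ⊥ → V ⊓ ⨆ i, U i ≠ ⊥

/-- The ring `S` has right Goldie rank `n`: so does `S` as a right module over itself. -/
def HasRightGoldieRank (S : Type*) [Ring S] (n : ℕ) : Prop :=
  HasGoldieRank Sᵐᵒᵖ S n

/-- A right Ore domain: a domain in which any two nonzero principal right ideals intersect
nontrivially. -/
def IsRightOreDomain (S : Type*) [Ring S] : Prop :=
  IsDomain S ∧ ∀ a b : S, a ≠ 0 → b ≠ 0 → ∃ r s : S, a * r = b * s ∧ a * r ≠ 0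

namespace Ambiskew

variable {K A : Type*} [Field K] [Ring A] [Algebra K A]

/-- For `ρ = 1` the Casimir element is central. -/
theorem commute_casimir (α : A ≃ₐ[K] A) (u : Subalgebra.center K A)
    (r : Ambiskew α (split α u 1) 1) : Commute r (casimir α u 1) := by
  have hu : ∀ a : A, (u : A) * a = a * u := fun a => (Subalgebra.mem_center_iff.1 u.2 a).symm
  have hA : ∀ a : A, Commute (ofBase a) (casimir α u 1) := fun a => by
    have h1 : (x : Ambiskew α (split α u 1) 1) * y * ofBase a = ofBase a * (x * y) := by
      rw [mul_assoc, y_mul_ofBase, ← mul_assoc, x_mul_ofBase, mul_assoc, α.symm_apply_apply]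
    simp only [commute_iff_eq, casimir, mul_sub, sub_mul, h1, ← map_mul, hu]
  have hxy : (x : Ambiskew α (split α u 1) 1) * y = y * x + (ofBase (u : A) - ofBase (α u)) := by
    rw [x_mul_y, ← map_sub, map_one, map_one, one_mul]
    simp [split]
  have hy : Commute y (casimir α u 1) := by
    simp only [commute_iff_eq, casimir, mul_sub, sub_mul, y_mul_ofBase]
    nth_rewrite 2 [hxy]
    noncomm_ring
  have hx : Commute x (casimir α u 1) := by
    have h := x_mul_ofBase (α := α) (v := split α u 1) (ρ := 1) (α (u : A))
    rw [α.symm_apply_apply] at h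
    simp only [commute_iff_eq, casimir, mul_sub, sub_mul, ← h]
    nth_rewrite 1 [hxy]
    noncomm_ring
  induction r using OreExtension.induct with
  | h0 => exact Commute.zero_left _
  | hadd f g hf hg => exact hf.add_left hg
  | hmon n b =>
    rw [OreExtension.monomial_eq]
    refine Commute.mul_left ?_ (hx.pow_left n)
    induction b using OreExtension.induct with
    | h0 => rw [map_zero]; exact Commute.zero_left _
    | hadd f g hf hg => rw [map_add]; exact hf.add_left hg
    | hmon k a =>
      rw [OreExtension.monomial_eq, map_mul, map_pow]
      exact (hA a).mul_left (hy.pow_left k)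

/-- The ideal `(z - λ)R` of the conformal algebra `R = R(A, α, u - α(u), 1)` with Casimir element
`z = xy - u`; note that `z - λ` is central. -/
noncomputable def casimirIdeal (α : A ≃ₐ[K] A) (u : Subalgebra.center K A) (lam : K) :
    TwoSidedIdeal (Ambiskew α (split α u 1) 1) :=
  TwoSidedIdeal.span {casimir α u 1 - ofBase (algebraMap K A lam)}

theorem mem_casimirIdeal (α : A ≃ₐ[K] A) (u : Subalgebra.center K A) (lam : K)
    (a : Ambiskew α (split α u 1) 1) :
    a ∈ casimirIdeal α u lam ↔ ∃ r, a = (casimir α u 1 - ofBase (algebraMap K A lam)) * r := by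
  refine TwoSidedIdeal.mem_span_singleton_of_central (fun s => ?_) a
  refine ((commute_casimir α u s).sub_right ?_).eq
  induction s using OreExtension.induct with
  | h0 => exact Commute.zero_left _
  | hadd f g hf hg => exact hf.add_left hg
  | hmon n b =>
    rw [OreExtension.monomial_eq]
    refine Commute.mul_left ?_ (Commute.pow_left ?_ n)
    · induction b using OreExtension.induct with
      | h0 => rw [map_zero]; exact Commute.zero_left _
      | hadd f g hf hg => rw [map_add]; exact hf.add_left hg
      | hmon k c =>
        rw [OreExtension.monomial_eq, map_mul, map_pow]
        refine Commute.mul_left ?_ (Commute.pow_left ?_ k)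
        · exact Commute.map (show Commute c (algebraMap K A lam) from (Algebra.commutes lam c).symm)
            (ofBase (α := α) (v := split α u 1) (ρ := 1))
        · exact (y_mul_ofBase (v := split α u 1) (ρ := 1) (algebraMap K A lam)).trans (by simp; rfl)
    · exact (x_mul_ofBase (v := split α u 1) (ρ := 1) (algebraMap K A lam)).trans (by simp; rfl)

/-- The ideal `(u + λ)A + αⁿ(u + λ)A` of `A`, for `u` central. -/
def sumIdeal (α : A ≃ₐ[K] A) (u : Subalgebra.center K A) (lam : K) (n : ℕ) :
    TwoSidedIdeal A :=
  TwoSidedIdeal.span {(u : A) + algebraMap K A lam} ⊔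
    TwoSidedIdeal.span {(α ^ n) ((u : A) + algebraMap K A lam)}

theorem mem_sumIdeal (α : A ≃ₐ[K] A) (u : Subalgebra.center K A) (lam : K) (n : ℕ) (a : A) :
    a ∈ sumIdeal α u lam n ↔ ∃ b c : A, a = ((u : A) + algebraMap K A lam) * b +
      (α ^ n) ((u : A) + algebraMap K A lam) * c := by
  have h1 : ∀ s : A, s * ((u : A) + algebraMap K A lam) = ((u : A) + algebraMap K A lam) * s :=
    Subalgebra.mem_center_iff.1 (add_mem u.2 (Subalgebra.algebraMap_mem _ lam))
  have h2 : ∀ s : A, s * (α ^ n) ((u : A) + algebraMap K A lam) =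
      (α ^ n) ((u : A) + algebraMap K A lam) * s := fun s => by
    have h := congrArg (α ^ n) (h1 ((α ^ n).symm s))
    simpa only [map_mul, AlgEquiv.apply_symm_apply] using h
  simp only [sumIdeal, TwoSidedIdeal.mem_sup, TwoSidedIdeal.mem_span_singleton_of_central h1,
    TwoSidedIdeal.mem_span_singleton_of_central h2]
  constructor
  · rintro ⟨_, ⟨b, rfl⟩, _, ⟨c, rfl⟩, rfl⟩
    exact ⟨b, c, rfl⟩
  · rintro ⟨b, c, rfl⟩
    exact ⟨_, ⟨b, rfl⟩, _, ⟨c, rfl⟩, rfl⟩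

end Ambiskew

/-!
Put `w = u + λ` and `T = R/(z - λ)R`. In `T` one has `xy = w` and `yx = α(w)`, so `T` is a
generalized Weyl algebra: each element is a sum of terms `ayⁿ` and `axⁿ`. The comaximality hypotheses
force `w ≠ 0`, so `T` embeds in the simple ring `S = A[y^{±1}; α]` in two ways, `(x, y) ↦ (wy⁻¹, y)`
and `(x, y) ↦ (y⁻¹, α(w)y)`, and `S` is got from `T` by inverting `y` in the first case and `x` in the
second. As `S` is simple, each nonzero ideal `Q` of `T` contains a power of `y` and a power of `x`
(`IsGWA.exists_pow_mem`). Since `xyⁿ = wyⁿ⁻¹` and `yⁿx = αⁿ(w)yⁿ⁻¹`, comaximality of `w` and `αⁿ(w)`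
for `n > m` then gives `yᵐ, xᵐ ∈ Q` (`IsGWA.Y_pow_mem`, `IsGWA.X_pow_mem`).

Let `D = A/M`. The algebra `T` acts on `Dᵐ` by matrices: `a ↦ diag(a, α(a), …, αᵐ⁻¹(a))`, with `y`
going to the shift above the diagonal and `x` to a matrix with entries `α(w), …, αᵐ⁻¹(w)` below the
diagonal; the relations hold because `w = αᵐ(w) = 0` in `D` (`WeylMatrix.isGWA`). The entries of `x`
are units of `D` by comaximality, so `T → Mₘ(D)` is onto (`WeylMatrix.subring_eq_top`). Its kernel
lies in every nonzero ideal `Q` (`IsGWA.mem_of_map_eq_zero`): the central elements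
`γⱼ = yᵐ⁻¹⁻ʲ xᵐ⁻¹ yʲ` of `A` generate the unit ideal (`IsGWA.exists_central_generators`), and if
`αʲ(a) ∈ M` then `γⱼa = yᵐ⁻¹⁻ʲ xᵐ⁻¹ αʲ(a) yʲ` lies in `Q`, since `xᵐ⁻¹w = xᵐy` and
`xᵐ⁻¹αᵐ(w) = yxᵐ`.

If `D` is simple then so is `Mₘ(D)`, and the kernel is both the least nonzero ideal of `T` and a
maximal ideal, hence the only nonzero prime ideal. If `D` is moreover a right Ore domain, then the
`m` rows of `Mₘ(D)` are uniform right ideals with direct sum `Mₘ(D)`, so the Goldie rank is `m`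
(`hasRightGoldieRank_of_ringEquiv_matrix`).
-/

/-! ### Nonzero ideals of a subring of a simple ring -/

/-- Let `T` embed in a simple ring `S` in such a way that an element `Y` of `T` becomes a unit of
`S` and each element of `S` has powers of `Y` as denominators, on the left and on the right. Then
each nonzero ideal of `T` contains a power of `Y`. -/
theorem exists_pow_mem_of_isSimpleRing {T S : Type*} [Ring T] [Ring S] [IsSimpleRing S]
    (ψ : T →+* S) (hψ : Function.Injective ψ) (Y : T) (y : Sˣ) (hy : ψ Y = y)
    (hr : ∀ s : S, ∃ (n : ℕ) (t : T), ψ t = s * (y : S) ^ n)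
    (hl : ∀ s : S, ∃ (n : ℕ) (t : T), ψ t = (y : S) ^ n * s)
    (Q : TwoSidedIdeal T) (hQ : Q ≠ ⊥) : ∃ k : ℕ, Y ^ k ∈ Q := by
  have cancelr : ∀ (k : ℕ), (y : S) ^ k * ((y⁻¹ : Sˣ) : S) ^ k = 1 := fun k => by
    rw [← Units.val_pow_eq_pow_val, ← Units.val_pow_eq_pow_val, inv_pow, Units.mul_inv]
  have cancell : ∀ (k : ℕ), ((y⁻¹ : Sˣ) : S) ^ k * (y : S) ^ k = 1 := fun k => by
    rw [← Units.val_pow_eq_pow_val, ← Units.val_pow_eq_pow_val, inv_pow, Units.inv_mul]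
  -- The ideal of `S` generated by `Q`: its elements lie in `Q` after clearing denominators.
  let I : TwoSidedIdeal S := .mk' {s | ∃ (n k : ℕ), ∃ q ∈ Q, ψ q = (y : S) ^ n * s * (y : S) ^ k}
    ⟨0, 0, 0, Q.zero_mem, by simp⟩
    (by
      rintro s t ⟨n, k, q, hq, h⟩ ⟨n', k', q', hq', h'⟩
      refine ⟨n + n', k + k', Y ^ n' * q * Y ^ k' + Y ^ n * q' * Y ^ k,
        Q.add_mem (Q.mul_mem_right _ _ (Q.mul_mem_left _ _ hq))
          (Q.mul_mem_right _ _ (Q.mul_mem_left _ _ hq')), ?_⟩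
      simp only [map_add, map_mul, map_pow, hy, h, h', mul_add, add_mul]
      congr 1
      · rw [add_comm n, pow_add, pow_add]; simp only [mul_assoc]
      · rw [add_comm k, pow_add, pow_add]; simp only [mul_assoc])
    (by
      rintro s ⟨n, k, q, hq, h⟩
      exact ⟨n, k, -q, Q.neg_mem hq, by simp [h]⟩)
    (by
      rintro t s ⟨n, k, q, hq, h⟩
      obtain ⟨N, t', ht'⟩ := hl (t * ((y⁻¹ : Sˣ) : S) ^ n)
      refine ⟨N, k, t' * q, Q.mul_mem_left _ _ hq, ?_⟩
      rw [map_mul, ht', h]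
      calc _ = (y : S) ^ N * t * (((y⁻¹ : Sˣ) : S) ^ n * (y : S) ^ n) * s * (y : S) ^ k := by
            simp only [mul_assoc]
        _ = _ := by rw [cancell, mul_one]; simp only [mul_assoc])
    (by
      rintro s t ⟨n, k, q, hq, h⟩
      obtain ⟨N, t', ht'⟩ := hr (((y⁻¹ : Sˣ) : S) ^ k * t)
      refine ⟨n, N, q * t', Q.mul_mem_right _ _ hq, ?_⟩
      rw [map_mul, ht', h]
      calc _ = (y : S) ^ n * s * ((y : S) ^ k * ((y⁻¹ : Sˣ) : S) ^ k) * t * (y : S) ^ N := by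
            simp only [mul_assoc]
        _ = _ := by rw [cancelr, mul_one]; simp only [mul_assoc])
  have hI : I ≠ ⊥ := by
    intro h
    refine hQ (eq_bot_iff.2 fun q hq => ?_)
    have : ψ q ∈ I := (TwoSidedIdeal.mem_mk' ..).2 ⟨0, 0, q, hq, by simp⟩
    rw [h, TwoSidedIdeal.mem_bot] at this
    exact (TwoSidedIdeal.mem_bot T).2 (hψ (by rw [this, map_zero]))
  obtain ⟨n, k, q, hq, h⟩ := (TwoSidedIdeal.mem_mk' ..).1 (IsSimpleRing.one_mem_of_ne_bot I hI)
  refine ⟨n + k, ?_⟩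
  have : q = Y ^ (n + k) := hψ (by rw [h, map_pow, hy, mul_one, pow_add])
  exact this ▸ hq

/-! ### Skew Laurent polynomials -/

namespace SkewLaurent

variable {K A : Type*} [Field K] [Ring A] [Algebra K A] (α : A ≃ₐ[K] A)

theorem single_add (n : ℤ) (a b : A) : single α n (a + b) = single α n a + single α n b :=
  SkewMonoidAlgebra.single_add _ _ _

theorem single_zero (n : ℤ) : single α n 0 = 0 :=
  SkewMonoidAlgebra.single_zero _

theorem single_zero_one : single α 0 1 = 1 := rfl

/-- The inclusion `A → A[y^{±1}; α]`. -/
noncomputable def ofBase : A →+* SkewLaurent α where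
  toFun := single α 0
  map_one' := rfl
  map_zero' := single_zero α 0
  map_add' := single_add α 0
  map_mul' a b := by rw [single_mul_single]; simp

theorem ofBase_apply (a : A) : ofBase α a = single α 0 a := rfl

/-- The coefficient of `yⁿ`, as an additive map. -/
noncomputable def coeffHom (n : ℤ) : SkewLaurent α →+ A :=
  (Finsupp.applyAddHom (Multiplicative.ofAdd n)).comp
    (SkewMonoidAlgebra.coeffAddEquiv (k := A) (G := Multiplicative ℤ)).toAddMonoidHom

theorem coeffHom_single (n k : ℤ) (a : A) :
    coeffHom α n (single α k a) = if k = n then a else 0 := by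
  classical
  refine (SkewMonoidAlgebra.coeff_single_apply (k := A) (G := Multiplicative ℤ)).trans ?_
  simp

/-- The power `yⁿ` as a unit. -/
noncomputable def unit (n : ℤ) : (SkewLaurent α)ˣ where
  val := single α n 1
  inv := single α (-n) 1
  val_inv := by rw [single_mul_single]; simp [single_zero_one]
  inv_val := by rw [single_mul_single]; simp [single_zero_one]

theorem unit_pow (n : ℤ) (k : ℕ) : (unit α n : SkewLaurent α) ^ k = single α (k * n) 1 := by
  induction k with
  | zero => simp [single_zero_one]
  | succ k ih =>
    rw [pow_succ, ih]
    change _ * single α n 1 = _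
    rw [single_mul_single, map_one, mul_one]
    congr 1
    push_cast
    ring

/-- A power of a monomial `b yⁿ` with `b ≠ 0` is a nonzero monomial. -/
theorem exists_single_pow [IsDomain A] (n : ℤ) {b : A} (hb : b ≠ 0) (k : ℕ) :
    ∃ p : A, p ≠ 0 ∧ single α n b ^ k = single α (k * n) p := by
  induction k with
  | zero => exact ⟨1, one_ne_zero, by simp [single_zero_one]⟩
  | succ k ih =>
    obtain ⟨p, hp, h⟩ := ih
    refine ⟨p * (α ^ (k * n)) b, mul_ne_zero hp (by simpa using hb), ?_⟩
    rw [pow_succ, h, single_mul_single]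
    congr 1
    push_cast
    ring

end SkewLaurent

/-! ### Generalized Weyl algebras -/

/-- The defining relations of the generalized Weyl algebra `A(α, w)`: a homomorphism `f : A → T` and
elements `X`, `Y` of `T` with `Ya = α(a)Y`, `Xa = α⁻¹(a)X`, `XY = w` and `YX = α(w)`, where `w` is
central in `A`. -/
structure IsGWA {K A T : Type*} [Field K] [Ring A] [Algebra K A] [Ring T]
    (α : A ≃ₐ[K] A) (w : A) (f : A →+* T) (X Y : T) : Prop where
  central : ∀ a, a * w = w * a
  Y_mul : ∀ a, Y * f a = f (α a) * Y
  X_mul : ∀ a, X * f a = f (α⁻¹ a) * X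
  X_mul_Y : X * Y = f w
  Y_mul_X : Y * X = f (α w)

/-- The monomial `Yⁿ` for `n ≥ 0`, and `X⁻ⁿ` for `n < 0`. -/
def weylMonomial {T : Type*} [Ring T] (X Y : T) : ℤ → T
  | .ofNat n => Y ^ n
  | .negSucc n => X ^ (n + 1)

section
variable {T : Type*} [Ring T] (X Y : T)

@[simp]
theorem weylMonomial_natCast (n : ℕ) : weylMonomial X Y n = Y ^ n := rfl

@[simp]
theorem weylMonomial_neg_natCast (n : ℕ) : weylMonomial X Y (-n) = X ^ n := by
  cases n with
  | zero => simp [weylMonomial]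
  | succ n => rfl

end

namespace IsGWA

variable {K A T : Type*} [Field K] [Ring A] [Algebra K A] [Ring T]
  {α : A ≃ₐ[K] A} {w : A} {f : A →+* T} {X Y : T}

theorem map_central (h : IsGWA α w f X Y) (β : A ≃ₐ[K] A) (a : A) : a * β w = β w * a := by
  simpa using congrArg β (h.central (β.symm a))

/-- The relations are symmetric in `X` and `Y`. -/
theorem symm (h : IsGWA α w f X Y) : IsGWA α⁻¹ (α w) f Y X where
  central := h.map_central α
  Y_mul := h.X_mul
  X_mul a := by rw [inv_inv]; exact h.Y_mul a
  X_mul_Y := h.Y_mul_X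
  Y_mul_X := by rw [h.X_mul_Y, ← AlgEquiv.mul_apply]; simp

theorem Y_pow_mul (h : IsGWA α w f X Y) (n : ℕ) (a : A) :
    Y ^ n * f a = f ((α ^ (n : ℤ)) a) * Y ^ n := by
  induction n with
  | zero => simp
  | succ n ih =>
    have : (α ^ ((n + 1 : ℕ) : ℤ)) a = α ((α ^ (n : ℤ)) a) := by
      push_cast
      rw [add_comm, zpow_add, zpow_one, AlgEquiv.mul_apply]
    rw [pow_succ', mul_assoc, ih, ← mul_assoc, h.Y_mul, this, mul_assoc]

theorem X_pow_mul (h : IsGWA α w f X Y) (n : ℕ) (a : A) :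
    X ^ n * f a = f ((α ^ (-n : ℤ)) a) * X ^ n := by
  rw [h.symm.Y_pow_mul, inv_zpow, zpow_neg]

theorem exists_Y_mul_weylMonomial (h : IsGWA α w f X Y) (n : ℤ) :
    ∃ c, Y * weylMonomial X Y n = f c * weylMonomial X Y (n + 1) := by
  cases n with
  | ofNat n => exact ⟨1, by rw [map_one, one_mul]; exact (pow_succ' Y n).symm⟩
  | negSucc n =>
    refine ⟨α w, ?_⟩
    have : (Int.negSucc n + 1) = -(n : ℤ) := by omega
    rw [this, weylMonomial_neg_natCast, weylMonomial, pow_succ', ← mul_assoc, h.Y_mul_X]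

theorem exists_X_mul_weylMonomial (h : IsGWA α w f X Y) (n : ℤ) :
    ∃ c, X * weylMonomial X Y n = f c * weylMonomial X Y (n - 1) := by
  cases n with
  | ofNat n =>
    cases n with
    | zero =>
      refine ⟨1, ?_⟩
      rw [map_one, one_mul]
      change X * Y ^ 0 = X ^ (0 + 1)
      simp
    | succ n =>
      refine ⟨w, ?_⟩
      have : (Int.ofNat (n + 1) - 1) = (n : ℤ) := by simp
      rw [this, weylMonomial_natCast, weylMonomial, pow_succ', ← mul_assoc, h.X_mul_Y]
  | negSucc n =>
    refine ⟨1, ?_⟩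
    have : (Int.negSucc n - 1) = Int.negSucc (n + 1) := by omega
    rw [this, map_one, one_mul]
    exact (pow_succ' X (n + 1)).symm

/-- The additive map `(cₙ)ₙ ↦ ∑ cₙ Zₙ`, where `Zₙ` is the monomial `Yⁿ` or `X⁻ⁿ`. -/
noncomputable def toSum (f : A →+* T) (X Y : T) : (ℤ →₀ A) →+ T :=
  Finsupp.liftAddHom fun n => (AddMonoidHom.mulRight (weylMonomial X Y n)).comp f.toAddMonoidHom

theorem toSum_single (n : ℤ) (a : A) :
    toSum f X Y (Finsupp.single n a) = f a * weylMonomial X Y n := by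
  simp [toSum]

theorem toSum_apply (c : ℤ →₀ A) :
    toSum f X Y c = c.sum fun n a => f a * weylMonomial X Y n := rfl

theorem mul_mem_range_toSum (h : IsGWA α w f X Y) {t : T} (ht : t ∈ (toSum f X Y).range) :
    (∀ a, f a * t ∈ (toSum f X Y).range) ∧ X * t ∈ (toSum f X Y).range ∧
      Y * t ∈ (toSum f X Y).range := by
  obtain ⟨c, rfl⟩ := ht
  induction c using Finsupp.induction_linear with
  | zero => simp
  | add c d hc hd =>
    simp only [map_add, mul_add]
    exact ⟨fun a => add_mem (hc.1 a) (hd.1 a), add_mem hc.2.1 hd.2.1, add_mem hc.2.2 hd.2.2⟩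
  | single n a =>
    rw [toSum_single]
    refine ⟨fun b => ⟨Finsupp.single n (b * a), by rw [toSum_single, map_mul, mul_assoc]⟩, ?_, ?_⟩
    · obtain ⟨c, hc⟩ := h.exists_X_mul_weylMonomial n
      exact ⟨Finsupp.single (n - 1) (α⁻¹ a * c), by
        rw [toSum_single, map_mul, mul_assoc, ← hc, ← mul_assoc, ← mul_assoc, h.X_mul]⟩
    · obtain ⟨c, hc⟩ := h.exists_Y_mul_weylMonomial n
      exact ⟨Finsupp.single (n + 1) (α a * c), by
        rw [toSum_single, map_mul, mul_assoc, ← hc, ← mul_assoc, ← mul_assoc, h.Y_mul]⟩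

/-- A homomorphism to the skew Laurent ring that sends the generators `X` and `Y` to nonzero
monomials `a y⁻¹` and `b y` is injective. -/
theorem injective_of_weylMonomial [IsDomain A] (ψ : T →+* SkewLaurent α)
    (hspan : ∀ t, t ∈ (toSum f X Y).range) (hf : ∀ a, ψ (f a) = SkewLaurent.ofBase α a)
    {a b : A} (ha : a ≠ 0) (hb : b ≠ 0) (hX : ψ X = SkewLaurent.single α (-1) a)
    (hY : ψ Y = SkewLaurent.single α 1 b) : Function.Injective ψ := by
  have hψ : ∀ n, ∃ p : A, p ≠ 0 ∧ ψ (weylMonomial X Y n) = SkewLaurent.single α n p := by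
    intro n
    obtain ⟨n, rfl | rfl⟩ := n.eq_nat_or_neg
    · simpa [hY] using SkewLaurent.exists_single_pow α 1 hb n
    · simpa [hX] using SkewLaurent.exists_single_pow α (-1) ha n
  choose p hp hψ using hψ
  refine (injective_iff_map_eq_zero ψ).2 fun t ht => ?_
  obtain ⟨c, rfl⟩ := hspan t
  suffices c = 0 by rw [this, map_zero]
  ext n
  have key : ∀ c : ℤ →₀ A,
      SkewLaurent.coeffHom α n (ψ (toSum f X Y c)) = c n * p n := by
    intro c
    induction c using Finsupp.induction_linear with
    | zero => simp
    | add c d hc hd => rw [map_add, map_add, map_add, hc, hd, Finsupp.add_apply, add_mul]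
    | single k a =>
      rw [toSum_single, map_mul, hf, hψ, SkewLaurent.ofBase_apply, SkewLaurent.single_mul_single,
        SkewLaurent.coeffHom_single, zero_add]
      rcases eq_or_ne k n with rfl | hkn
      · simp
      · simp [hkn]
  have h := key c
  rw [ht, map_zero] at h
  simpa [hp n] using h.symm

/-- The skew Laurent ring is obtained from the image of `T` by inverting any element `V` that goes
to `y` or to `y⁻¹`. -/
theorem exists_pow_mem [IsDomain A] [IsSimpleRing (SkewLaurent α)] (ψ : T →+* SkewLaurent α)
    (hspan : ∀ t, t ∈ (toSum f X Y).range) (hf : ∀ a, ψ (f a) = SkewLaurent.ofBase α a)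
    {a b : A} (ha : a ≠ 0) (hb : b ≠ 0) (hX : ψ X = SkewLaurent.single α (-1) a)
    (hY : ψ Y = SkewLaurent.single α 1 b) {V : T} {e : ℤ} (he : e = 1 ∨ e = -1)
    (hV : ψ V = SkewLaurent.single α e 1) (Q : TwoSidedIdeal T) (hQ : Q ≠ ⊥) :
    ∃ k : ℕ, V ^ k ∈ Q := by
  have hVj : ∀ (j : ℕ) (a : A), ψ (f a * V ^ j) = SkewLaurent.single α (j * e) a := by
    intro j a
    rw [map_mul, map_pow, hV, hf, SkewLaurent.ofBase_apply]
    change _ * (SkewLaurent.unit α e : SkewLaurent α) ^ j = _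
    rw [SkewLaurent.unit_pow, SkewLaurent.single_mul_single]
    simp
  have hindex : ∀ k : ℤ, ∃ j : ℕ, (j * e : ℤ) = k.natAbs * e + k := by
    intro k
    rcases he with rfl | rfl
    · exact ⟨(k.natAbs + k).toNat, by omega⟩
    · exact ⟨(k.natAbs - k).toNat, by omega⟩
  have hunit : ψ V = (SkewLaurent.unit α e : SkewLaurent α) := hV
  refine exists_pow_mem_of_isSimpleRing ψ (injective_of_weylMonomial ψ hspan hf ha hb hX hY) V
    (SkewLaurent.unit α e) hunit (fun s => ?_) (fun s => ?_) Q hQ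
  · induction s using SkewLaurent.induct with
    | hsingle k a =>
      obtain ⟨j, hj⟩ := hindex k
      refine ⟨k.natAbs, f a * V ^ j, ?_⟩
      rw [hVj, hj, SkewLaurent.unit_pow, SkewLaurent.single_mul_single]
      simp [add_comm]
    | hadd s s' h h' =>
      obtain ⟨n, t, ht⟩ := h
      obtain ⟨n', t', ht'⟩ := h'
      refine ⟨n + n', t * V ^ n' + t' * V ^ n, ?_⟩
      rw [map_add, map_mul, map_mul, map_pow, map_pow, hunit, ht, ht', add_mul, mul_assoc,
        mul_assoc, ← pow_add, ← pow_add, add_comm n']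
  · induction s using SkewLaurent.induct with
    | hsingle k a =>
      obtain ⟨j, hj⟩ := hindex k
      refine ⟨k.natAbs, f ((α ^ ((k.natAbs : ℤ) * e)) a) * V ^ j, ?_⟩
      rw [hVj, hj, SkewLaurent.unit_pow, SkewLaurent.single_mul_single, one_mul]
    | hadd s s' h h' =>
      obtain ⟨n, t, ht⟩ := h
      obtain ⟨n', t', ht'⟩ := h'
      refine ⟨n + n', V ^ n' * t + V ^ n * t', ?_⟩
      rw [map_add, map_mul, map_mul, map_pow, map_pow, hunit, ht, ht', mul_add, ← mul_assoc,
        ← mul_assoc, ← pow_add, ← pow_add, add_comm n']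

/-- Descent: if `w` and `αⁿ(w)` are comaximal for all `n > m`, then an ideal that contains a power
of `Y` contains `Yᵐ`, because `XYⁿ = wYⁿ⁻¹` and `YⁿX = αⁿ(w)Yⁿ⁻¹`. -/
theorem Y_pow_mem (h : IsGWA α w f X Y) {m : ℕ}
    (hco : ∀ n : ℕ, m < n → ∃ b c, w * b + (α ^ (n : ℤ)) w * c = 1) (Q : TwoSidedIdeal T)
    {k : ℕ} (hk : Y ^ k ∈ Q) : Y ^ m ∈ Q := by
  rcases le_total k m with hkm | hmk
  · obtain ⟨l, rfl⟩ := Nat.exists_eq_add_of_le hkm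
    rw [pow_add]
    exact Q.mul_mem_right _ _ hk
  · induction k, hmk using Nat.le_induction with
    | base => exact hk
    | succ n hmn ih =>
      refine ih ?_
      obtain ⟨b, c, hbc⟩ := hco (n + 1) (by omega)
      have h1 : X * Y ^ (n + 1) = f w * Y ^ n := by rw [pow_succ', ← mul_assoc, h.X_mul_Y]
      have h2 : Y ^ (n + 1) * X = f ((α ^ ((n + 1 : ℕ) : ℤ)) w) * Y ^ n := by
        rw [pow_succ, mul_assoc, h.Y_mul_X, h.Y_pow_mul, ← AlgEquiv.mul_apply]
        push_cast
        rw [zpow_add, zpow_one]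
      have h3 : Y ^ n = f b * (X * Y ^ (n + 1)) + f c * (Y ^ (n + 1) * X) := by
        rw [h1, h2, ← mul_assoc, ← mul_assoc, ← add_mul, ← map_mul, ← map_mul, ← map_add,
          h.central, h.map_central, hbc, map_one, one_mul]
      rw [h3]
      exact Q.add_mem (Q.mul_mem_left _ _ (Q.mul_mem_left _ _ hk))
        (Q.mul_mem_left _ _ (Q.mul_mem_right _ _ hk))

theorem X_pow_mem (h : IsGWA α w f X Y) {m : ℕ}
    (hco : ∀ n : ℕ, m < n → ∃ b c, w * b + (α ^ (n : ℤ)) w * c = 1) (Q : TwoSidedIdeal T)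
    {k : ℕ} (hk : X ^ k ∈ Q) : X ^ m ∈ Q := by
  refine h.symm.Y_pow_mem (fun n hmn => ?_) Q hk
  obtain ⟨b, c, hbc⟩ := hco n hmn
  refine ⟨(α ^ (1 - n : ℤ)) c, (α ^ (1 - n : ℤ)) b, ?_⟩
  have e1 : α w = (α ^ (1 - n : ℤ)) ((α ^ (n : ℤ)) w) := by
    rw [← AlgEquiv.mul_apply, ← zpow_add]; simp
  have e2 : (α⁻¹ ^ (n : ℤ)) (α w) = (α ^ (1 - n : ℤ)) w := by
    rw [← AlgEquiv.mul_apply, inv_zpow', ← zpow_add_one, add_comm, sub_eq_add_neg]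
  rw [e2]
  nth_rewrite 1 [e1]
  rw [← map_mul, ← map_mul, ← map_add, add_comm, hbc, map_one]

end IsGWA

/-! ### The elements `Yˡ Xˡ⁺ʲ Yʲ` -/

/-- A maximal left ideal is prime with respect to products `cd` with `d` central. -/
theorem Ideal.IsMaximal.mem_or_mem_of_central {A : Type*} [Ring A] {N : Ideal A}
    (hN : N.IsMaximal) {c d : A}
    (hd : ∀ a, a * d = d * a) (hcd : c * d ∈ N) : c ∈ N ∨ d ∈ N := by
  by_contra! hcon
  obtain ⟨hcN, hdN⟩ := hcon
  have hlt : N < N ⊔ Ideal.span {c} :=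
    left_lt_sup.2 fun h => hcN (h (Ideal.subset_span (Set.mem_singleton c)))
  have h1 : (1 : A) ∈ N ⊔ Ideal.span {c} := by
    rw [(Ideal.isMaximal_def.1 hN).2 _ hlt]
    trivial
  obtain ⟨n, hn, s, hs, hns⟩ := Submodule.mem_sup.1 h1
  obtain ⟨a, rfl⟩ := Ideal.mem_span_singleton'.1 hs
  refine hdN ?_
  have : d = d * n + a * (c * d) := by
    rw [← hd, ← mul_assoc, ← add_mul, hns, one_mul]
  rw [this]
  exact N.add_mem (N.mul_mem_left _ hn) (N.mul_mem_left _ hcd)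

namespace IsGWA

section Comaximal

variable {K A T : Type*} [Field K] [Ring A] [Algebra K A] [Ring T]
  {α : A ≃ₐ[K] A} {w : A} {f : A →+* T} {X Y : T}

/-- `YˡXˡ` is the product of the central elements `α(w), …, αˡ(w)` of `A`. -/
theorem exists_Y_pow_mul_X_pow (h : IsGWA α w f X Y) (l : ℕ) :
    ∃ γ : A, f γ = Y ^ l * X ^ l ∧ (∀ a, a * γ = γ * a) ∧
      ∀ N : Ideal A, N.IsMaximal → γ ∈ N → ∃ k : ℤ, 1 ≤ k ∧ k ≤ l ∧ (α ^ k) w ∈ N := by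
  induction l with
  | zero =>
    exact ⟨1, by simp, by simp, fun N hN h1 => absurd ((Ideal.eq_top_iff_one N).2 h1) hN.ne_top⟩
  | succ l ih =>
    obtain ⟨γ, hγ, hc, hN⟩ := ih
    refine ⟨(α ^ ((l : ℤ) + 1)) w * γ, ?_, fun a => ?_, fun N hNm hmem => ?_⟩
    · rw [map_mul, hγ, zpow_add_one, AlgEquiv.mul_apply, ← mul_assoc, ← h.Y_pow_mul, ← h.Y_mul_X,
        pow_succ Y, pow_succ' X]
      simp only [mul_assoc]
    · rw [← mul_assoc, h.map_central, mul_assoc, hc, mul_assoc]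
    · rcases hNm.mem_or_mem_of_central hc hmem with h1 | h1
      · exact ⟨l + 1, by omega, by omega, h1⟩
      · obtain ⟨k, hk1, hk2, hk⟩ := hN N hNm h1
        exact ⟨k, hk1, by omega, hk⟩

theorem exists_X_pow_mul_Y_pow (h : IsGWA α w f X Y) (l : ℕ) :
    ∃ γ : A, f γ = X ^ l * Y ^ l ∧ (∀ a, a * γ = γ * a) ∧
      ∀ N : Ideal A, N.IsMaximal → γ ∈ N → ∃ k : ℤ, 1 - l ≤ k ∧ k ≤ 0 ∧ (α ^ k) w ∈ N := by
  obtain ⟨γ, hγ, hc, hN⟩ := h.symm.exists_Y_pow_mul_X_pow l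
  refine ⟨γ, hγ, hc, fun N hNm hmem => ?_⟩
  obtain ⟨k, hk1, hk2, hk⟩ := hN N hNm hmem
  refine ⟨1 - k, by omega, by omega, ?_⟩
  rwa [← AlgEquiv.mul_apply, inv_zpow', ← zpow_add_one, neg_add_eq_sub] at hk

/-- Two translates `αⁱ(w)`, `αʲ(w)` that lie in the same proper left ideal have `i = j` or
`|i - j| = m`, if `w` and `αⁿ(w)` are comaximal for all `n ≥ 1` different from `m`. -/
theorem eq_or_eq_add_of_mem (h : IsGWA α w f X Y) {m : ℕ}
    (hco : ∀ n : ℕ, 1 ≤ n → n ≠ m → ∃ b c, w * b + (α ^ (n : ℤ)) w * c = 1)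
    {N : Ideal A} (hN : N ≠ ⊤) {i j : ℤ} (hij : i < j) (hi : (α ^ i) w ∈ N) (hj : (α ^ j) w ∈ N) :
    j = i + m := by
  by_contra hne
  obtain ⟨n, hn⟩ := Int.eq_ofNat_of_zero_le (sub_nonneg.2 hij.le)
  obtain ⟨b, c, hbc⟩ := hco n (by omega) (by omega)
  refine hN ((Ideal.eq_top_iff_one N).2 ?_)
  have h1 := congrArg (α ^ i) hbc
  rw [map_add, map_mul, map_mul, map_one, ← AlgEquiv.mul_apply, ← zpow_add, ← hn,
    add_sub_cancel, ← h.map_central, ← h.map_central] at h1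
  rw [← h1]
  exact N.add_mem (N.mul_mem_left _ hi) (N.mul_mem_left _ hj)

/-- The elements `γⱼ = Yᵐ⁻¹⁻ʲ Xᵐ⁻¹ Yʲ`, for `0 ≤ j < m`, lie in `A`, are central in it, and generate
the unit ideal. They play the part of the diagonal idempotents of an `m × m` matrix ring. -/
theorem exists_central_generators (h : IsGWA α w f X Y) {m : ℕ} (hm : 1 ≤ m)
    (hco : ∀ n : ℕ, 1 ≤ n → n ≠ m → ∃ b c, w * b + (α ^ (n : ℤ)) w * c = 1) :
    ∃ γ : ℕ → A, (∀ j < m, f (γ j) = Y ^ (m - 1 - j) * X ^ (m - 1) * Y ^ j) ∧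
      (∀ j a, a * γ j = γ j * a) ∧ ∀ L : Ideal A, (∀ j < m, γ j ∈ L) → L = ⊤ := by
  choose γ hγ hc hN using h.exists_Y_pow_mul_X_pow
  choose δ hδ hd hN' using h.exists_X_pow_mul_Y_pow
  refine ⟨fun j => γ (m - 1 - j) * δ j, fun j hj => ?_, fun j a => ?_, fun L hL => ?_⟩
  · have : m - 1 = (m - 1 - j) + j := by omega
    rw [map_mul, hγ, hδ]
    nth_rewrite 4 [this]
    rw [pow_add]
    simp only [mul_assoc]
  · rw [← mul_assoc, hc, mul_assoc, hd, mul_assoc]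
  · by_contra hLt
    obtain ⟨N, hNm, hLN⟩ := Ideal.exists_le_maximal L hLt
    -- `γⱼ` is the product of the `αᵏ(w)` with `1 - j ≤ k ≤ m - 1 - j`
    have key : ∀ j < m, ∃ k : ℤ, 1 - j ≤ k ∧ k ≤ m - 1 - j ∧ (α ^ k) w ∈ N := by
      intro j hj
      rcases hNm.mem_or_mem_of_central (hd _) (hLN (hL j hj)) with h1 | h1
      · obtain ⟨k, hk1, hk2, hk⟩ := hN _ N hNm h1
        exact ⟨k, by omega, by omega, hk⟩
      · obtain ⟨k, hk1, hk2, hk⟩ := hN' _ N hNm h1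
        exact ⟨k, by omega, by omega, hk⟩
    obtain ⟨k, hk1, hk2, hk⟩ := key 0 (by omega)
    -- the window of index `m - k` avoids both `k` and `k - m`
    obtain ⟨k', hk1', hk2', hk'⟩ := key (m - k).toNat (by omega)
    rcases lt_trichotomy k k' with hlt | rfl | hlt
    · have := h.eq_or_eq_add_of_mem hco hNm.ne_top hlt hk hk'
      omega
    · omega
    · have := h.eq_or_eq_add_of_mem hco hNm.ne_top hlt hk' hk
      omega

/-- An ideal `Q` that contains `Xᵐ` and `Yᵐ` contains `aYⁿ` as soon as `αʲ(a)` lies in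
`wA + αᵐ(w)A` for all `j < m - n`, and `aXⁿ` as soon as this holds for `n ≤ j < m`. -/
theorem mul_pow_mem (h : IsGWA α w f X Y) {m : ℕ} (hm : 1 ≤ m)
    (hco : ∀ n : ℕ, 1 ≤ n → n ≠ m → ∃ b c, w * b + (α ^ (n : ℤ)) w * c = 1)
    {Q : TwoSidedIdeal T} (hX : X ^ m ∈ Q) (hY : Y ^ m ∈ Q) (a : A) (n : ℕ) :
    ((∀ j < m, j + n < m → ∃ b c, (α ^ (j : ℤ)) a = w * b + (α ^ (m : ℤ)) w * c) →
        f a * Y ^ n ∈ Q) ∧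
      ((∀ j < m, n ≤ j → ∃ b c, (α ^ (j : ℤ)) a = w * b + (α ^ (m : ℤ)) w * c) →
        f a * X ^ n ∈ Q) := by
  obtain ⟨γ, hγ, hc, htop⟩ := h.exists_central_generators hm hco
  have hpow : ∀ Z : T, Z ^ m ∈ Q → ∀ k, m ≤ k → Z ^ k ∈ Q := by
    intro Z hZ k hk
    obtain ⟨l, rfl⟩ := Nat.exists_eq_add_of_le hk
    rw [pow_add]
    exact Q.mul_mem_right _ _ hZ
  have hXm : X ^ m = X ^ (m - 1) * X := by rw [← pow_succ, Nat.sub_add_cancel hm]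
  have hXm' : X ^ m = X * X ^ (m - 1) := by rw [← pow_succ', Nat.sub_add_cancel hm]
  have hXM : ∀ b c, X ^ (m - 1) * f (w * b + (α ^ (m : ℤ)) w * c) ∈ Q := by
    intro b c
    have e : (α ^ (-((m - 1 : ℕ) : ℤ))) ((α ^ (m : ℤ)) w) = α w := by
      rw [← AlgEquiv.mul_apply, ← zpow_add, Nat.cast_sub hm]
      simp
    rw [map_add, map_mul, map_mul, mul_add, ← mul_assoc, ← mul_assoc, ← h.X_mul_Y, ← mul_assoc,
      ← hXm, h.X_pow_mul, e, ← h.Y_mul_X, mul_assoc Y, ← hXm']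
    exact Q.add_mem (Q.mul_mem_right _ _ (Q.mul_mem_right _ _ hX))
      (Q.mul_mem_right _ _ (Q.mul_mem_left _ _ hX))
  have hgen : ∀ j < m, (∃ b c, (α ^ (j : ℤ)) a = w * b + (α ^ (m : ℤ)) w * c) →
      f (γ j) * f a ∈ Q := by
    rintro j hj ⟨b, c, hbc⟩
    rw [hγ j hj, mul_assoc, h.Y_pow_mul, hbc, ← mul_assoc, mul_assoc (Y ^ _)]
    exact Q.mul_mem_right _ _ (Q.mul_mem_left _ _ (hXM b c))
  have hcomm : ∀ j, f (γ j) * f a = f a * f (γ j) := fun j => by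
    rw [← map_mul, ← map_mul, hc]
  -- it suffices to check membership after multiplication by each `γⱼ`
  have hred : ∀ t : T, (∀ j < m, f (γ j) * t ∈ Q) → t ∈ Q := by
    intro t ht
    let L : Ideal A :=
      { carrier := {b | f b * t ∈ Q}
        zero_mem' := by simp [Q.zero_mem]
        add_mem' := fun {b c} hb hc => by
          change f (b + c) * t ∈ Q
          rw [map_add, add_mul]
          exact Q.add_mem hb hc
        smul_mem' := fun b c hc => by
          change f (b * c) * t ∈ Q
          rw [map_mul, mul_assoc]
          exact Q.mul_mem_left _ _ hc }
    have h1 : (1 : A) ∈ L := (htop L ht).symm ▸ Submodule.mem_top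
    simpa [L] using h1
  constructor
  · refine fun ha => hred _ fun j hj => ?_
    by_cases hjn : j + n < m
    · rw [← mul_assoc]
      exact Q.mul_mem_right _ _ (hgen j hj (ha j hj hjn))
    · rw [← mul_assoc, hcomm, mul_assoc, hγ j hj, mul_assoc, ← pow_add]
      exact Q.mul_mem_left _ _ (Q.mul_mem_left _ _ (hpow Y hY _ (by omega)))
  · refine fun ha => hred _ fun j hj => ?_
    by_cases hjn : n ≤ j
    · rw [← mul_assoc]
      exact Q.mul_mem_right _ _ (hgen j hj (ha j hj hjn))
    · obtain ⟨δ, hδ, -⟩ := h.exists_Y_pow_mul_X_pow j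
      obtain ⟨k, rfl⟩ := Nat.exists_eq_add_of_le (Nat.le_of_lt (not_le.1 hjn))
      have e : X ^ (m - 1) * Y ^ j * X ^ (j + k) =
          f ((α ^ (-((m - 1 : ℕ) : ℤ))) δ) * X ^ (m - 1 + k) := by
        rw [pow_add X j, ← mul_assoc, mul_assoc (X ^ (m - 1)), ← hδ, h.X_pow_mul, mul_assoc,
          ← pow_add]
      rw [← mul_assoc, hcomm, mul_assoc, hγ j hj, mul_assoc (Y ^ _), mul_assoc (Y ^ _), e]
      exact Q.mul_mem_left _ _ (Q.mul_mem_left _ _ (Q.mul_mem_left _ _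
        (hpow X hX _ (by omega))))

end Comaximal

end IsGWA

/-! ### The matrix representation -/

namespace WeylMatrix

variable {K A D : Type*} [Field K] [Ring A] [Algebra K A] [Ring D]
  (α : A ≃ₐ[K] A) (w : A) (π : A →+* D) (m : ℕ)

/-- The representation `a ↦ diag(π(a), π(α(a)), …, π(αᵐ⁻¹(a)))` of `A`. -/
noncomputable def diag : A →+* Matrix (Fin m) (Fin m) D :=
  (Matrix.diagonalRingHom (Fin m) D).comp
    (RingHom.pi fun i : Fin m => π.comp ((α ^ (i : ℤ) : A ≃ₐ[K] A) : A →+* A))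

theorem diag_eq (a : A) :
    diag α π m a = Matrix.diagonal fun i : Fin m => π ((α ^ (i : ℤ)) a) := rfl

/-- The matrix by which `Y` acts, with entries `1` above the diagonal. -/
def matY : Matrix (Fin m) (Fin m) D := fun i j => if (j : ℕ) = i + 1 then 1 else 0

/-- The matrix by which `X` acts, with entries `π(α(w)), …, π(αᵐ⁻¹(w))` below the diagonal. -/
def matX : Matrix (Fin m) (Fin m) D :=
  fun i j => if (i : ℕ) = j + 1 then π ((α ^ (i : ℤ)) w) else 0

theorem matY_pow_apply (n : ℕ) (i j : Fin m) :
    (matY m ^ n : Matrix (Fin m) (Fin m) D) i j = if (j : ℕ) = i + n then 1 else 0 := by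
  induction n generalizing i with
  | zero =>
    rw [pow_zero, Matrix.one_apply]
    simp only [Fin.ext_iff, add_zero, eq_comm]
  | succ n ih =>
    rw [pow_succ', Matrix.mul_apply]
    simp only [ih]
    by_cases hi : (i : ℕ) + 1 < m
    · rw [Finset.sum_eq_single ⟨i + 1, hi⟩]
      · simp [matY, add_assoc, add_comm 1 n]
      · intro k _ hk
        have : (k : ℕ) ≠ i + 1 := fun h => hk (Fin.ext h)
        simp [matY, this]
      · simp
    · rw [Finset.sum_eq_zero, if_neg (by omega)]
      intro k _
      have : (k : ℕ) ≠ i + 1 := by omega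
      simp [matY, this]

theorem matX_pow_apply (hunit : ∀ i : ℕ, 1 ≤ i → i < m → IsUnit (π ((α ^ (i : ℤ)) w))) (n : ℕ)
    (i j : Fin m) :
    ((i : ℕ) = j + n → IsUnit ((matX α w π m ^ n) i j)) ∧
      ((i : ℕ) ≠ j + n → (matX α w π m ^ n) i j = 0) := by
  induction n generalizing i with
  | zero =>
    rw [pow_zero, Matrix.one_apply]
    refine ⟨fun h => ?_, fun h => ?_⟩
    · rw [if_pos (Fin.ext h)]
      exact isUnit_one
    · rw [if_neg fun h' => h (congrArg Fin.val h')]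
  | succ n ih =>
    rw [pow_succ', Matrix.mul_apply]
    by_cases hi : 1 ≤ (i : ℕ)
    · have him : (i : ℕ) - 1 < m := by omega
      rw [Finset.sum_eq_single ⟨i - 1, him⟩]
      · have h1 : matX α w π m i ⟨i - 1, him⟩ = π ((α ^ (i : ℤ)) w) := by
          simp only [matX]
          rw [if_pos (by omega)]
        rw [h1]
        refine ⟨fun h => (hunit i hi i.2).mul ((ih _).1 ?_), fun h => ?_⟩
        · simp only
          omega
        · rw [(ih _).2 (by simp only; omega), mul_zero]
      · intro k _ hk
        have : (i : ℕ) ≠ k + 1 := fun h => hk (Fin.ext (by simp only; omega))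
        simp [matX, this]
      · simp
    · refine ⟨fun h => by omega, fun _ => Finset.sum_eq_zero fun k _ => ?_⟩
      have : (i : ℕ) ≠ k + 1 := by omega
      simp [matX, this]

/-- If `π` kills `w` and `αᵐ(w)`, these matrices satisfy the relations of the generalized Weyl
algebra. -/
theorem isGWA (hw : ∀ a, a * w = w * a) (h0 : π w = 0) (hm : π ((α ^ (m : ℤ)) w) = 0) :
    IsGWA α w (diag α π m) (matX α w π m) (matY m) := by
  have hc : ∀ (k : ℤ) (a : A), a * (α ^ k) w = (α ^ k) w * a := fun k a => by
    simpa using congrArg (α ^ k) (hw ((α ^ k).symm a))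
  refine ⟨hw, fun a => ?_, fun a => ?_, ?_, ?_⟩
  · ext i j
    rw [diag_eq, diag_eq, Matrix.mul_diagonal, Matrix.diagonal_mul]
    by_cases hij : (j : ℕ) = i + 1
    · simp only [matY, if_pos hij, one_mul, mul_one]
      rw [hij, ← AlgEquiv.mul_apply, ← zpow_add_one]
      push_cast
      rfl
    · simp [matY, hij]
  · ext i j
    rw [diag_eq, diag_eq, Matrix.mul_diagonal, Matrix.diagonal_mul]
    by_cases hij : (i : ℕ) = j + 1
    · simp only [matX, if_pos hij]
      have : (α ^ (i : ℤ)) (α⁻¹ a) = (α ^ (j : ℤ)) a := by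
        rw [← AlgEquiv.mul_apply, ← zpow_sub_one, hij]
        simp
      rw [this, ← map_mul, ← map_mul, hc]
    · simp [matX, hij]
  · ext i j
    rw [diag_eq, Matrix.mul_apply, Matrix.diagonal_apply]
    by_cases hi : 1 ≤ (i : ℕ)
    · have him : (i : ℕ) - 1 < m := by omega
      rw [Finset.sum_eq_single ⟨i - 1, him⟩]
      · have e : (i : ℕ) = (i - 1) + 1 := by omega
        by_cases hij : i = j
        · subst hij
          simp [matX, matY, ← e]
        · have : (j : ℕ) ≠ (i - 1) + 1 := fun h => hij (Fin.ext (by omega))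
          simp [matY, this, hij]
      · intro k _ hk
        have : (i : ℕ) ≠ k + 1 := fun h => hk (Fin.ext (by simp only; omega))
        simp [matX, this]
      · simp
    · rw [Finset.sum_eq_zero fun k _ => ?_]
      · have : (i : ℕ) = 0 := by omega
        simp [this, h0]
      · have : (i : ℕ) ≠ k + 1 := by omega
        simp [matX, this]
  · ext i j
    have e1 : (α ^ (i : ℤ)) (α w) = (α ^ ((i : ℤ) + 1)) w := by
      rw [zpow_add_one, AlgEquiv.mul_apply]
    rw [diag_eq, Matrix.mul_apply, Matrix.diagonal_apply, e1]
    by_cases hi : (i : ℕ) + 1 < m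
    · rw [Finset.sum_eq_single ⟨i + 1, hi⟩]
      · by_cases hij : i = j
        · subst hij
          simp [matX, matY]
        · have : ¬ (i : ℕ) = j := fun h => hij (Fin.ext h)
          simp [matX, this, hij]
      · intro k _ hk
        have : (k : ℕ) ≠ i + 1 := fun h => hk (Fin.ext h)
        simp [matY, this]
      · simp
    · rw [Finset.sum_eq_zero fun k _ => ?_]
      · have : (i : ℤ) + 1 = m := by omega
        rw [this, hm, ite_self]
      · have : (k : ℕ) ≠ i + 1 := by omega
        simp [matY, this]

/-- A subring of the matrix ring is everything if it contains the matrices of `X`, `Y` and of the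
elements of `A`: it contains a unit multiple of each matrix unit. -/
theorem subring_eq_top (hm : 1 ≤ m) (hπ : Function.Surjective π)
    (hunit : ∀ i : ℕ, 1 ≤ i → i < m → IsUnit (π ((α ^ (i : ℤ)) w)))
    (B : Subring (Matrix (Fin m) (Fin m) D)) (hA : ∀ a, diag α π m a ∈ B)
    (hX : matX α w π m ∈ B) (hY : matY m ∈ B) : B = ⊤ := by
  let i₀ : Fin m := ⟨0, hm⟩
  let i₁ : Fin m := ⟨m - 1, by omega⟩
  have hYlast : (matY m ^ (m - 1) : Matrix (Fin m) (Fin m) D) = Matrix.single i₀ i₁ 1 := by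
    ext i j
    rw [matY_pow_apply, Matrix.single_apply]
    congr 1
    simp only [i₀, i₁, Fin.ext_iff, eq_iff_iff]
    omega
  have hXlast : ∃ ε : D, IsUnit ε ∧ matX α w π m ^ (m - 1) = Matrix.single i₁ i₀ ε := by
    refine ⟨_, (matX_pow_apply α w π m hunit (m - 1) i₁ i₀).1 (by simp [i₀, i₁]), ?_⟩
    ext i j
    rw [Matrix.single_apply]
    split_ifs with hij
    · rw [hij.1, hij.2]
    · refine (matX_pow_apply α w π m hunit (m - 1) i j).2 ?_
      simp only [i₀, i₁, Fin.ext_iff] at hij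
      omega
  obtain ⟨ε, ⟨ε, rfl⟩, hε⟩ := hXlast
  have h00 : ∀ d : D, Matrix.single i₀ i₀ d ∈ B := by
    intro d
    obtain ⟨a, ha⟩ := hπ ((ε⁻¹ : Dˣ) * d)
    have h : matY m ^ (m - 1) * matX α w π m ^ (m - 1) * diag α π m a = Matrix.single i₀ i₀ d := by
      rw [hYlast, hε, Matrix.single_mul_single_same, one_mul]
      ext i j
      rw [diag_eq, Matrix.mul_diagonal, Matrix.single_apply, Matrix.single_apply]
      split_ifs with hij
      · rw [← hij.2]
        simp [i₀, ha]
      · simp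
    rw [← h]
    exact B.mul_mem (B.mul_mem (B.pow_mem hY _) (B.pow_mem hX _)) (hA a)
  have hi0 : ∀ (i : Fin m) (d : D), Matrix.single i i₀ d ∈ B := by
    intro i d
    obtain ⟨η, hη⟩ := (matX_pow_apply α w π m hunit i i i₀).1 (by simp [i₀])
    have h : matX α w π m ^ (i : ℕ) * Matrix.single i₀ i₀ ((η⁻¹ : Dˣ) * d) =
        Matrix.single i i₀ d := by
      ext k l
      rcases eq_or_ne l i₀ with rfl | hl
      · rw [Matrix.mul_single_apply_same, Matrix.single_apply]
        rcases eq_or_ne k i with rfl | hk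
        · simp [← hη]
        · rw [(matX_pow_apply α w π m hunit i k i₀).2 (fun h => hk (Fin.ext (by simpa [i₀] using h)))]
          simp [hk.symm]
      · rw [Matrix.mul_single_apply_of_ne _ _ _ _ _ hl, Matrix.single_apply,
          if_neg fun h => hl h.2.symm]
    rw [← h]
    exact B.mul_mem (B.pow_mem hX _) (h00 _)
  have hij : ∀ (i j : Fin m) (d : D), Matrix.single i j d ∈ B := by
    intro i j d
    have h : Matrix.single i i₀ d * matY m ^ (j : ℕ) = Matrix.single i j d := by
      ext k l
      rcases eq_or_ne k i with rfl | hk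
      · rw [Matrix.single_mul_apply_same, matY_pow_apply, Matrix.single_apply]
        simp [i₀, Fin.ext_iff, eq_comm]
      · rw [Matrix.single_mul_apply_of_ne _ _ _ _ _ hk, Matrix.single_apply,
          if_neg fun h => hk h.1.symm]
    rw [← h]
    exact B.mul_mem (hi0 i d) (B.pow_mem hY _)
  refine eq_top_iff.2 fun N _ => ?_
  rw [Matrix.matrix_eq_sum_single N]
  exact B.sum_mem fun i _ => B.sum_mem fun j _ => hij i j _

end WeylMatrix

/-! ### The least nonzero ideal of a generalized Weyl algebra -/

namespace IsGWA

open WeylMatrix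

variable {K A T D : Type*} [Field K] [Ring A] [Algebra K A] [Ring T] [Ring D]
  {α : A ≃ₐ[K] A} {w : A} {f : A →+* T} {X Y : T} {π : A →+* D} {m : ℕ}

/-- `αⁱ(w)` is comaximal to `w`, which `π` kills, so it becomes a unit. -/
theorem isUnit_map (h : IsGWA α w f X Y)
    (hco : ∀ n : ℕ, 1 ≤ n → n ≠ m → ∃ b c, w * b + (α ^ (n : ℤ)) w * c = 1) (h0 : π w = 0)
    (i : ℕ) (hi : 1 ≤ i) (him : i < m) : IsUnit (π ((α ^ (i : ℤ)) w)) := by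
  obtain ⟨b, c, hbc⟩ := hco i hi him.ne
  have h1 := congrArg π hbc
  rw [map_add, map_mul, h0, zero_mul, zero_add, map_mul, map_one] at h1
  refine ⟨⟨_, π c, h1, ?_⟩, rfl⟩
  rw [← map_mul, h.map_central, map_mul, h1]

/-- The kernel of the matrix representation lies in every ideal that contains `Xᵐ` and `Yᵐ`: the
`(i, i + n)` entry of the image of `∑ cₙ Zₙ` is a unit multiple of `π(αⁱ(cₙ))`. -/
theorem mem_of_map_eq_zero (h : IsGWA α w f X Y) (hm : 1 ≤ m)
    (hco : ∀ n : ℕ, 1 ≤ n → n ≠ m → ∃ b c, w * b + (α ^ (n : ℤ)) w * c = 1)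
    (hπ : ∀ a, π a = 0 ↔ ∃ b c, a = w * b + (α ^ (m : ℤ)) w * c)
    (hspan : ∀ t, t ∈ (toSum f X Y).range) (φ : T →+* Matrix (Fin m) (Fin m) D)
    (hφ : ∀ a, φ (f a) = diag α π m a) (hφX : φ X = matX α w π m) (hφY : φ Y = matY m)
    {Q : TwoSidedIdeal T} (hX : X ^ m ∈ Q) (hY : Y ^ m ∈ Q) {t : T} (ht : φ t = 0) : t ∈ Q := by
  have h0 : π w = 0 := (hπ w).2 ⟨1, 0, by simp⟩
  have hunit := h.isUnit_map hco h0
  have hZ : ∀ (n : ℤ) (i j : Fin m),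
      ((j : ℤ) = i + n → IsUnit (φ (weylMonomial X Y n) i j)) ∧
        ((j : ℤ) ≠ i + n → φ (weylMonomial X Y n) i j = 0) := by
    intro n i j
    obtain ⟨n, rfl | rfl⟩ := n.eq_nat_or_neg
    · rw [weylMonomial_natCast, map_pow, hφY, matY_pow_apply]
      refine ⟨fun hn => ?_, fun hn => if_neg (by omega)⟩
      rw [if_pos (by omega)]
      exact isUnit_one
    · rw [weylMonomial_neg_natCast, map_pow, hφX]
      have := matX_pow_apply α w π m hunit n i j
      exact ⟨fun hn => this.1 (by omega), fun hn => this.2 (by omega)⟩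
  obtain ⟨c, rfl⟩ := hspan t
  have key : ∀ (c : ℤ →₀ A) (n : ℤ) (i j : Fin m), (j : ℤ) = i + n →
      φ (toSum f X Y c) i j = π ((α ^ (i : ℤ)) (c n)) * φ (weylMonomial X Y n) i j := by
    intro c n i j hij
    induction c using Finsupp.induction_linear with
    | zero => simp
    | add c d hc hd => simp only [map_add, Matrix.add_apply, hc, hd, Finsupp.add_apply, add_mul]
    | single k a =>
      rw [toSum_single, map_mul, hφ, diag_eq, Matrix.diagonal_mul]
      rcases eq_or_ne k n with rfl | hkn
      · simp
      · rw [(hZ k i j).2 (by omega), Finsupp.single_eq_of_ne hkn.symm]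
        simp
  have hcoef : ∀ (n : ℤ) (i j : Fin m), (j : ℤ) = i + n →
      ∃ b d, (α ^ (i : ℤ)) (c n) = w * b + (α ^ (m : ℤ)) w * d := by
    intro n i j hij
    have h1 := key c n i j hij
    rw [ht, Matrix.zero_apply] at h1
    exact (hπ _).1 (((hZ n i j).1 hij).mul_left_eq_zero.1 h1.symm)
  rw [toSum_apply]
  refine Q.finsuppSum_mem _ fun n _ => ?_
  obtain ⟨n, rfl | rfl⟩ := n.eq_nat_or_neg
  · rw [weylMonomial_natCast]
    exact (h.mul_pow_mem hm hco hX hY _ n).1 fun j hj hjn =>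
      hcoef n ⟨j, hj⟩ ⟨j + n, hjn⟩ (by simp)
  · rw [weylMonomial_neg_natCast]
    exact (h.mul_pow_mem hm hco hX hY _ n).2 fun j hj hjn =>
      hcoef (-n) ⟨j, hj⟩ ⟨j - n, by omega⟩ (by simp only; omega)

theorem surjective_of_map_eq (h : IsGWA α w f X Y) (hm : 1 ≤ m)
    (hco : ∀ n : ℕ, 1 ≤ n → n ≠ m → ∃ b c, w * b + (α ^ (n : ℤ)) w * c = 1)
    (h0 : π w = 0) (hπ : Function.Surjective π) (φ : T →+* Matrix (Fin m) (Fin m) D)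
    (hφ : ∀ a, φ (f a) = diag α π m a) (hφX : φ X = matX α w π m) (hφY : φ Y = matY m) :
    Function.Surjective φ := by
  rw [← RingHom.range_eq_top]
  exact subring_eq_top α w π m hm hπ (h.isUnit_map hco h0) _ (fun a => ⟨f a, hφ a⟩) ⟨X, hφX⟩
    ⟨Y, hφY⟩

end IsGWA

/-- If the kernel of an epimorphism `φ` onto a simple ring is nonzero and lies in all nonzero
ideals, then it is the only nonzero prime ideal. -/
theorem TwoSidedIdeal.ne_bot_and_isPrimeIdeal_iff {T S : Type*} [Ring T] [Ring S] [IsSimpleRing S]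
    (φ : T →+* S) (hφ : Function.Surjective φ) (hne : TwoSidedIdeal.ker φ ≠ ⊥)
    (hmin : ∀ Q : TwoSidedIdeal T, Q ≠ ⊥ → TwoSidedIdeal.ker φ ≤ Q) (q : TwoSidedIdeal T) :
    (q ≠ ⊥ ∧ q.IsPrimeIdeal) ↔ q = TwoSidedIdeal.ker φ := by
  -- the kernel is a maximal ideal
  have hmax : ∀ I : TwoSidedIdeal T, ¬ I ≤ TwoSidedIdeal.ker φ → ∃ a ∈ I, φ a = 1 := by
    intro I hI
    obtain ⟨t, htI, ht⟩ := Set.not_subset.1 hI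
    let J : TwoSidedIdeal S := .mk' (φ '' I) ⟨0, I.zero_mem, map_zero φ⟩
      (by rintro _ _ ⟨a, ha, rfl⟩ ⟨b, hb, rfl⟩; exact ⟨a + b, I.add_mem ha hb, map_add ..⟩)
      (by rintro _ ⟨a, ha, rfl⟩; exact ⟨-a, I.neg_mem ha, map_neg ..⟩)
      (by
        rintro s _ ⟨a, ha, rfl⟩
        obtain ⟨r, rfl⟩ := hφ s
        exact ⟨r * a, I.mul_mem_left _ _ ha, map_mul ..⟩)
      (by
        rintro _ s ⟨a, ha, rfl⟩
        obtain ⟨r, rfl⟩ := hφ s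
        exact ⟨a * r, I.mul_mem_right _ _ ha, map_mul ..⟩)
    have hJ : ∀ s, s ∈ J ↔ s ∈ φ '' I := TwoSidedIdeal.mem_mk' _ _ _ _ _ _
    have h1 : (1 : S) ∈ J := IsSimpleRing.one_mem_of_ne_zero_mem J
      (fun h => ht ((TwoSidedIdeal.mem_ker φ).2 h)) ((hJ _).2 ⟨t, htI, rfl⟩)
    exact (hJ 1).1 h1
  have hone : (1 : T) ∉ TwoSidedIdeal.ker φ := by
    rw [TwoSidedIdeal.mem_ker, map_one]
    exact one_ne_zero
  constructor
  · rintro ⟨hq, hprime⟩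
    refine le_antisymm ?_ (hmin q hq)
    by_contra hcon
    obtain ⟨a, ha, ha1⟩ := hmax q hcon
    refine hprime.1 ((TwoSidedIdeal.one_mem_iff q).1 ?_)
    have : 1 - a ∈ q := hmin q hq ((TwoSidedIdeal.mem_ker φ).2 (by
      rw [map_sub, ha1, map_one, sub_self]))
    simpa using q.add_mem this ha
  · rintro rfl
    refine ⟨hne, fun htop => hone (htop ▸ TwoSidedIdeal.mem_top T), fun I J hIJ => ?_⟩
    by_contra! hcon
    obtain ⟨a, ha, ha1⟩ := hmax I hcon.1
    obtain ⟨b, hb, hb1⟩ := hmax J hcon.2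
    have := (TwoSidedIdeal.mem_ker φ).1 (hIJ a ha b hb)
    rw [map_mul, ha1, hb1, mul_one] at this
    exact one_ne_zero this

/-! ### Goldie rank of matrix rings -/

section Goldie

variable {S D : Type*} [Ring S] [Ring D] {m : ℕ}

/-- The right ideal of the matrices that vanish outside the `i`-th row. -/
def rowSubmodule (e : S ≃+* Matrix (Fin m) (Fin m) D) (i : Fin m) : Submodule Sᵐᵒᵖ S where
  carrier := {s | ∀ k ≠ i, ∀ j, e s k j = 0}
  zero_mem' := by simp
  add_mem' := fun {s t} hs ht k hk j => by
    rw [map_add, Matrix.add_apply, hs k hk, ht k hk, add_zero]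
  smul_mem' := fun r s hs k hk j => by
    change e (s * r.unop) k j = 0
    rw [map_mul, Matrix.mul_apply]
    exact Finset.sum_eq_zero fun l _ => by rw [hs k hk, zero_mul]

theorem mul_symm_single_of_mem_rowSubmodule (e : S ≃+* Matrix (Fin m) (Fin m) D) {i : Fin m} {s : S}
    (hs : s ∈ rowSubmodule e i) (j : Fin m) (d : D) :
    s * e.symm (Matrix.single j i d) = e.symm (Matrix.single i i (e s i j * d)) := by
  apply e.injective
  rw [map_mul, e.apply_symm_apply, e.apply_symm_apply]
  ext k l
  rcases eq_or_ne l i with rfl | hl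
  · rw [Matrix.mul_single_apply_same]
    rcases eq_or_ne k l with rfl | hk
    · simp
    · rw [hs k hk, zero_mul, Matrix.single_apply, if_neg fun h => hk h.1.symm]
  · rw [Matrix.mul_single_apply_of_ne _ _ _ _ _ hl, Matrix.single_apply,
      if_neg fun h => hl h.2.symm]

/-- The rows of a matrix ring over a right Ore domain are uniform. -/
theorem isUniform_rowSubmodule (hD : IsRightOreDomain D) (e : S ≃+* Matrix (Fin m) (Fin m) D)
    (i : Fin m) : (rowSubmodule e i).IsUniform := by
  have := hD.1
  have hentry : ∀ V : Submodule Sᵐᵒᵖ S, V ≤ rowSubmodule e i → V ≠ ⊥ →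
      ∃ v ∈ V, ∃ j, e v i j ≠ 0 := by
    intro V hV hne
    obtain ⟨v, hv, hv0⟩ := V.ne_bot_iff.1 hne
    refine ⟨v, hv, ?_⟩
    by_contra! hcon
    refine hv0 (e.injective ?_)
    rw [map_zero]
    ext k j
    rcases eq_or_ne k i with rfl | hk
    · exact hcon j
    · exact hV hv k hk j
  refine ⟨(Submodule.ne_bot_iff _).2 ⟨e.symm (Matrix.single i i 1), fun k hk j => ?_, fun h => ?_⟩,
    fun V W hV hW hV0 hW0 => ?_⟩
  · rw [e.apply_symm_apply, Matrix.single_apply, if_neg fun h => hk h.1.symm]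
  · have h1 := congrFun (congrFun (congrArg e h) i) i
    rw [e.apply_symm_apply, map_zero] at h1
    simp at h1
  · obtain ⟨v, hv, j, hvj⟩ := hentry V hV hV0
    obtain ⟨v', hv', j', hvj'⟩ := hentry W hW hW0
    obtain ⟨r, s, hrs, hne⟩ := hD.2 _ _ hvj hvj'
    refine (Submodule.ne_bot_iff _).2 ⟨e.symm (Matrix.single i i (e v i j * r)), ⟨?_, ?_⟩, fun h => ?_⟩
    · rw [← mul_symm_single_of_mem_rowSubmodule e (hV hv)]
      exact V.smul_mem (MulOpposite.op _) hv
    · rw [hrs, ← mul_symm_single_of_mem_rowSubmodule e (hW hv')]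
      exact W.smul_mem (MulOpposite.op _) hv'
    · have h1 := congrFun (congrFun (congrArg e h) i) i
      rw [e.apply_symm_apply, map_zero] at h1
      exact hne (by simpa using h1)

theorem iSupIndep_rowSubmodule (e : S ≃+* Matrix (Fin m) (Fin m) D) :
    iSupIndep (rowSubmodule e) := by
  intro i
  -- the other rows lie in the submodule of matrices with zero `i`-th row
  let N : Submodule Sᵐᵒᵖ S :=
    { carrier := {s | ∀ j, e s i j = 0}
      zero_mem' := by simp
      add_mem' := fun {s t} hs ht j => by rw [map_add, Matrix.add_apply, hs, ht, add_zero]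
      smul_mem' := fun r s hs j => by
        change e (s * r.unop) i j = 0
        rw [map_mul, Matrix.mul_apply]
        exact Finset.sum_eq_zero fun l _ => by rw [hs, zero_mul] }
  have hN : ⨆ (j) (_ : j ≠ i), rowSubmodule e j ≤ N :=
    iSup₂_le fun j hj s hs l => hs i hj.symm l
  refine Disjoint.mono_right hN (Submodule.disjoint_def.2 fun s hs hsN => e.injective ?_)
  rw [map_zero]
  ext k j
  rcases eq_or_ne k i with rfl | hk
  · exact hsN j
  · exact hs k hk j

theorem iSup_rowSubmodule (e : S ≃+* Matrix (Fin m) (Fin m) D) : ⨆ i, rowSubmodule e i = ⊤ := by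
  refine eq_top_iff.2 fun s _ => ?_
  have hs : s = ∑ i, e.symm (Matrix.single i i 1) * s := by
    rw [← Finset.sum_mul, ← map_sum]
    have : ∑ i : Fin m, Matrix.single i i (1 : D) = 1 := by
      ext k l
      simp only [Matrix.sum_apply, Matrix.single_apply, Matrix.one_apply]
      rw [Finset.sum_eq_single k] <;> simp +contextual
    rw [this, map_one, one_mul]
  rw [hs]
  refine Submodule.sum_mem _ fun i _ => Submodule.mem_iSup_of_mem i fun k hk j => ?_
  rw [map_mul, e.apply_symm_apply, Matrix.single_mul_apply_of_ne _ _ _ _ _ hk]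

theorem hasRightGoldieRank_of_ringEquiv_matrix (hD : IsRightOreDomain D)
    (e : S ≃+* Matrix (Fin m) (Fin m) D) : HasRightGoldieRank S m :=
  ⟨rowSubmodule e, isUniform_rowSubmodule hD e, iSupIndep_rowSubmodule e, fun V hV => by
    rwa [iSup_rowSubmodule, inf_top_eq]⟩

end Goldie

/-! ### The factor `R/(z - λ)R` as a generalized Weyl algebra -/

/-- The generalized Weyl algebra relations in the skew Laurent ring: `X = ay⁻¹` and `Y = by` with
`a`, `b` central and `a α⁻¹(b) = w`. -/
theorem SkewLaurent.isGWA {K A : Type*} [Field K] [Ring A] [Algebra K A] (α : A ≃ₐ[K] A)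
    {w a b : A} (ha : ∀ c, c * a = a * c) (hb : ∀ c, c * b = b * c)
    (hw : a * α⁻¹ b = w) :
    IsGWA α w (SkewLaurent.ofBase α) (SkewLaurent.single α (-1) a) (SkewLaurent.single α 1 b) := by
  have hb' : ∀ c, c * α⁻¹ b = α⁻¹ b * c := fun c => by
    simpa using congrArg (α⁻¹ : A ≃ₐ[K] A) (hb (α c))
  refine ⟨fun c => ?_, fun c => ?_, fun c => ?_, ?_, ?_⟩
  · rw [← hw, ← mul_assoc, ha, mul_assoc, hb', mul_assoc]
  · rw [ofBase_apply, ofBase_apply, single_mul_single, single_mul_single]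
    simp [hb]
  · rw [ofBase_apply, ofBase_apply, single_mul_single, single_mul_single]
    simp [ha]
  · rw [ofBase_apply, single_mul_single, zpow_neg_one, hw]
    rfl
  · have hαa : b * α a = α w := by
      rw [← hw, map_mul, ← AlgEquiv.mul_apply, mul_inv_cancel, AlgEquiv.one_apply, hb]
    rw [ofBase_apply, single_mul_single, zpow_one, hαa]
    rfl

namespace Ambiskew

open IsGWA

variable {K A : Type*} [Field K] [Ring A] [Algebra K A] (α : A ≃ₐ[K] A)
  (u : Subalgebra.center K A) (lam : K)

theorem central_add_algebraMap (a : A) :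
    a * ((u : A) + algebraMap K A lam) = ((u : A) + algebraMap K A lam) * a :=
  Subalgebra.mem_center_iff.1 (add_mem u.2 (Subalgebra.algebraMap_mem _ lam)) a

/-- The homomorphism from the conformal ambiskew polynomial algebra to a ring in which the relations
of the generalized Weyl algebra `A(α, u + λ)` hold. -/
noncomputable def liftGWA {B : Type*} [Ring B] {f : A →+* B} {X Y : B}
    (h : IsGWA α ((u : A) + algebraMap K A lam) f X Y) : Ambiskew α (split α u 1) 1 →+* B :=
  OreExtension.lift
    (OreExtension.lift f Y fun a => by
      change Y * f a = f (α a) * Y + f 0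
      rw [h.Y_mul, map_zero, add_zero])
    X fun p => by
      induction p using OreExtension.induct with
      | h0 => simp
      | hadd p q hp hq => simp only [map_add, mul_add, add_mul, hp, hq]; abel
      | hmon n a =>
        have hX : ∀ a, X * f a = f (α.symm a) * X := h.X_mul
        have hXY : X * Y = Y * X + f ((u : A) - α u) := by
          rw [h.X_mul_Y, h.Y_mul_X, ← map_add, map_add α, AlgEquiv.commutes]
          congr 1
          abel
        have hv : ((split α u 1 : Subalgebra.center K A) : A) = u - α u := by
          simp [split]
        rw [OreExtension.monomial_eq]
        induction n with
        | zero => simp [hX]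
        | succ n ih =>
          rw [pow_succ, ← mul_assoc]
          generalize OreExtension.C a * OreExtension.X ^ n = p at ih
          rw [SkewDerivation.leibniz, map_mul, map_mul, ← mul_assoc, ih]
          simp only [map_mul, map_add, SkewPoly.beta_X, SkewPoly.delta_X, OreExtension.lift_X,
            OreExtension.lift_C, map_one, one_mul, hv, add_mul, mul_assoc, hXY, mul_add]
          abel

variable {α u lam}

@[simp]
theorem liftGWA_ofBase {B : Type*} [Ring B] {f : A →+* B} {X Y : B}
    (h : IsGWA α ((u : A) + algebraMap K A lam) f X Y) (a : A) :
    liftGWA α u lam h (ofBase a) = f a := by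
  simp [liftGWA, ofBase]

@[simp]
theorem liftGWA_x {B : Type*} [Ring B] {f : A →+* B} {X Y : B}
    (h : IsGWA α ((u : A) + algebraMap K A lam) f X Y) : liftGWA α u lam h x = X := by
  simp [liftGWA, x]

@[simp]
theorem liftGWA_y {B : Type*} [Ring B] {f : A →+* B} {X Y : B}
    (h : IsGWA α ((u : A) + algebraMap K A lam) f X Y) : liftGWA α u lam h y = Y := by
  simp [liftGWA, y]

/-- The homomorphism that `liftGWA` induces on `R/(z - λ)R`. -/
noncomputable def factorLift {B : Type*} [Ring B] {f : A →+* B} {X Y : B}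
    (h : IsGWA α ((u : A) + algebraMap K A lam) f X Y) :
    (casimirIdeal α u lam).FactorRing →+* B :=
  (casimirIdeal α u lam).ringCon.lift (liftGWA α u lam h) fun a b hab => by
    obtain ⟨r, hr⟩ := (mem_casimirIdeal α u lam _).1 ((TwoSidedIdeal.rel_iff _ _ _).1 hab)
    have h0 : liftGWA α u lam h (casimir α u 1 - ofBase (algebraMap K A lam)) = 0 := by
      simp [casimir, h.X_mul_Y]
    rw [RingCon.ker_apply, ← sub_eq_zero, ← map_sub, hr, map_mul, h0, zero_mul]

theorem factorLift_toFactor {B : Type*} [Ring B] {f : A →+* B} {X Y : B}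
    (h : IsGWA α ((u : A) + algebraMap K A lam) f X Y) (r : Ambiskew α (split α u 1) 1) :
    factorLift h ((casimirIdeal α u lam).toFactor r) = liftGWA α u lam h r := rfl

variable (α u lam)

theorem isGWA_factor : IsGWA α ((u : A) + algebraMap K A lam)
    ((casimirIdeal α u lam).toFactor.comp ofBase) ((casimirIdeal α u lam).toFactor x)
    ((casimirIdeal α u lam).toFactor y) := by
  have hxy : (casimirIdeal α u lam).toFactor (x * y) =
      (casimirIdeal α u lam).toFactor (ofBase ((u : A) + algebraMap K A lam)) := by
    rw [← sub_eq_zero, ← map_sub, ← TwoSidedIdeal.mem_ker, TwoSidedIdeal.ker_ringCon_mk',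
      mem_casimirIdeal]
    refine ⟨1, ?_⟩
    rw [casimir, map_add]
    noncomm_ring
  refine ⟨central_add_algebraMap u lam, fun a => ?_, fun a => ?_, ?_, ?_⟩
  · simp only [RingHom.comp_apply, ← map_mul, y_mul_ofBase]
  · simp only [RingHom.comp_apply, ← map_mul, x_mul_ofBase]
    rfl
  · rw [← map_mul, hxy]
    rfl
  · have h1 : (y : Ambiskew α (split α u 1) 1) * x =
        x * y - ofBase ((split α u 1 : Subalgebra.center K A) : A) := by
      rw [x_mul_y]
      simp
    rw [← map_mul, h1, map_sub, hxy, ← map_sub, ← map_sub]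
    simp [split, add_comm]
    rfl

theorem mem_range_toSum_factor (t : (casimirIdeal α u lam).FactorRing) :
    t ∈ (toSum ((casimirIdeal α u lam).toFactor.comp ofBase) ((casimirIdeal α u lam).toFactor x)
      ((casimirIdeal α u lam).toFactor y)).range := by
  have h := isGWA_factor α u lam
  obtain ⟨r, rfl⟩ := RingCon.mk'_surjective _ t
  set N := (toSum ((casimirIdeal α u lam).toFactor.comp ofBase)
    ((casimirIdeal α u lam).toFactor x) ((casimirIdeal α u lam).toFactor y)).range
  have hpowX : ∀ n : ℕ, ∀ t ∈ N, (casimirIdeal α u lam).toFactor x ^ n * t ∈ N := by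
    intro n t ht
    induction n with
    | zero => rwa [pow_zero, one_mul]
    | succ n ih =>
      rw [pow_succ', mul_assoc]
      exact (h.mul_mem_range_toSum ih).2.1
  have hpowY : ∀ n : ℕ, ∀ t ∈ N, (casimirIdeal α u lam).toFactor y ^ n * t ∈ N := by
    intro n t ht
    induction n with
    | zero => rwa [pow_zero, one_mul]
    | succ n ih =>
      rw [pow_succ', mul_assoc]
      exact (h.mul_mem_range_toSum ih).2.2
  have hone : (1 : (casimirIdeal α u lam).FactorRing) ∈ N :=
    ⟨Finsupp.single 0 1, by
      rw [toSum_single, map_one, one_mul]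
      exact pow_zero _⟩
  induction r using OreExtension.induct with
  | h0 => rw [map_zero]; exact zero_mem _
  | hadd p q hp hq => rw [map_add]; exact add_mem hp hq
  | hmon n b =>
    rw [OreExtension.monomial_eq, map_mul, map_pow]
    induction b using OreExtension.induct with
    | h0 => rw [map_zero, map_zero, zero_mul]; exact zero_mem _
    | hadd p q hp hq => rw [map_add, map_add, add_mul]; exact add_mem hp hq
    | hmon k a =>
      rw [OreExtension.monomial_eq, map_mul, map_mul, map_pow, map_pow, mul_assoc,
        ← mul_one ((casimirIdeal α u lam).ringCon.mk' OreExtension.X ^ n)]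
      exact (h.mul_mem_range_toSum (hpowY k _ (hpowX n _ hone))).1 a

/-! ### Primes of `R/(z - λ)R` -/

/-- If `u + λ` and `αⁿ(u + λ)` are comaximal exactly for `n ≠ m`, and `M = (u + λ)A + αᵐ(u + λ)A` is
such that `A/M` is simple, then `R/(z - λ)R` maps onto `Mₘ(A/M)`, with kernel its only nonzero
prime ideal. -/
theorem exists_surjective_matrix [IsDomain A] [IsSimpleRing (SkewLaurent α)] {m : ℕ} (hm : 1 ≤ m)
    (hn : ∀ n : ℕ, 1 ≤ n → n ≠ m → sumIdeal α u lam n = ⊤)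
    [IsSimpleRing (sumIdeal α u lam m).FactorRing] :
    ∃ φ : (casimirIdeal α u lam).FactorRing →+*
        Matrix (Fin m) (Fin m) (sumIdeal α u lam m).FactorRing,
      Function.Surjective φ ∧ ∀ q : TwoSidedIdeal (casimirIdeal α u lam).FactorRing,
        (q ≠ ⊥ ∧ q.IsPrimeIdeal) ↔ q = TwoSidedIdeal.ker φ := by
  set w : A := (u : A) + algebraMap K A lam with hw
  have hcen : ∀ a, a * w = w * a := central_add_algebraMap u lam
  have hcen' : ∀ a, a * α w = α w * a := (isGWA_factor α u lam).map_central α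
  have hco : ∀ n : ℕ, 1 ≤ n → n ≠ m → ∃ b c, w * b + (α ^ (n : ℤ)) w * c = 1 := by
    intro n h1 h2
    have : (1 : A) ∈ sumIdeal α u lam n := (hn n h1 h2) ▸ TwoSidedIdeal.mem_top A
    obtain ⟨b, c, hbc⟩ := (mem_sumIdeal α u lam n 1).1 this
    exact ⟨b, c, by rw [zpow_natCast]; exact hbc.symm⟩
  have hw0 : w ≠ 0 := by
    intro h0
    obtain ⟨b, c, hbc⟩ := hco (m + 1) (by omega) (by omega)
    rw [h0, map_zero, zero_mul, zero_mul, add_zero] at hbc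
    exact zero_ne_one hbc
  let π := (sumIdeal α u lam m).toFactor
  have hπ : ∀ a, π a = 0 ↔ ∃ b c, a = w * b + (α ^ (m : ℤ)) w * c := by
    intro a
    rw [← TwoSidedIdeal.mem_ker, TwoSidedIdeal.ker_ringCon_mk', mem_sumIdeal, zpow_natCast]
  have hπw : π w = 0 := (hπ w).2 ⟨1, 0, by simp⟩
  have hmat := WeylMatrix.isGWA α w π m hcen hπw ((hπ _).2 ⟨0, 1, by simp⟩)
  have hgwa := isGWA_factor α u lam
  have hspan := mem_range_toSum_factor α u lam
  -- the two embeddings in the skew Laurent ring: `Y ↦ y`, `X ↦ wy⁻¹` and `Y ↦ α(w)y`, `X ↦ y⁻¹`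
  have hψ₁ := SkewLaurent.isGWA α (a := w) (b := 1) (w := w) hcen (by simp) (by simp)
  have hψ₂ := SkewLaurent.isGWA α (a := 1) (b := α w) (w := w) (by simp) hcen'
    (by rw [one_mul, ← AlgEquiv.mul_apply, inv_mul_cancel, AlgEquiv.one_apply])
  have hαw0 : α w ≠ 0 := by simpa using hw0
  let φ := factorLift hmat
  have hφf : ∀ a, φ ((casimirIdeal α u lam).toFactor (ofBase a)) = WeylMatrix.diag α π m a :=
    fun a => liftGWA_ofBase hmat a
  have hφX : φ ((casimirIdeal α u lam).toFactor x) = WeylMatrix.matX α w π m := liftGWA_x hmat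
  have hφY : φ ((casimirIdeal α u lam).toFactor y) = WeylMatrix.matY m := liftGWA_y hmat
  have hsurj : Function.Surjective φ :=
    hgwa.surjective_of_map_eq hm hco hπw (RingCon.mk'_surjective _) φ hφf hφX hφY
  have : Nonempty (Fin m) := ⟨⟨0, hm⟩⟩
  refine ⟨φ, hsurj, TwoSidedIdeal.ne_bot_and_isPrimeIdeal_iff φ hsurj (fun hbot => ?_)
    fun Q hQ t ht => ?_⟩
  · -- `Yᵐ` is a nonzero element of the kernel
    have hmem : (casimirIdeal α u lam).toFactor y ^ m ∈ TwoSidedIdeal.ker φ := by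
      rw [TwoSidedIdeal.mem_ker, map_pow, hφY]
      ext i j
      rw [WeylMatrix.matY_pow_apply, if_neg (by omega), Matrix.zero_apply]
    rw [hbot, TwoSidedIdeal.mem_bot] at hmem
    have h1 := congrArg (factorLift hψ₁) hmem
    rw [map_zero, map_pow, factorLift_toFactor, liftGWA_y] at h1
    exact ((SkewLaurent.unit α 1) ^ m).ne_zero (by rw [Units.val_pow_eq_pow_val]; exact h1)
  · obtain ⟨k, hk⟩ := exists_pow_mem (factorLift hψ₁) hspan (liftGWA_ofBase hψ₁) hw0 one_ne_zero
      (liftGWA_x hψ₁) (liftGWA_y hψ₁) (V := (casimirIdeal α u lam).toFactor y) (Or.inl rfl) (liftGWA_y hψ₁) Q hQ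
    obtain ⟨l, hl⟩ := exists_pow_mem (factorLift hψ₂) hspan (liftGWA_ofBase hψ₂) one_ne_zero hαw0
      (liftGWA_x hψ₂) (liftGWA_y hψ₂) (V := (casimirIdeal α u lam).toFactor x) (Or.inr rfl) (liftGWA_x hψ₂) Q hQ
    have hco' : ∀ n : ℕ, m < n → ∃ b c, w * b + (α ^ (n : ℤ)) w * c = 1 :=
      fun n hmn => hco n (by omega) (by omega)
    exact hgwa.mem_of_map_eq_zero hm hco hπ hspan φ hφf hφX hφY (hgwa.X_pow_mem hco' Q hl)
      (hgwa.Y_pow_mem hco' Q hk) ((TwoSidedIdeal.mem_ker φ).1 ht)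

end Ambiskew

/-- The factor ring of a maximal ideal is simple. -/
theorem TwoSidedIdeal.isSimpleRing_factorRing {S : Type*} [Ring S] {M : TwoSidedIdeal S}
    (hM : IsCoatom M) : IsSimpleRing M.FactorRing := by
  have hker : ∀ a, M.toFactor a = 0 ↔ a ∈ M := fun a => by
    rw [← TwoSidedIdeal.mem_ker, TwoSidedIdeal.ker_ringCon_mk']
  have : Nontrivial M.FactorRing := by
    refine ⟨1, 0, fun h => hM.1 ((TwoSidedIdeal.one_mem_iff M).1 ((hker 1).1 ?_))⟩
    rw [map_one, h]
  refine IsSimpleRing.of_eq_bot_or_eq_top fun I => ?_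
  have hle : M ≤ I.comap M.toFactor := fun a ha => by
    rw [TwoSidedIdeal.mem_comap, (hker a).2 ha]
    exact I.zero_mem
  rcases hM.le_iff.1 hle with h | h
  · right
    rw [← TwoSidedIdeal.one_mem_iff, ← map_one M.toFactor, ← TwoSidedIdeal.mem_comap, h]
    exact TwoSidedIdeal.mem_top S
  · left
    refine eq_bot_iff.2 fun b hb => ?_
    obtain ⟨a, rfl⟩ := RingCon.mk'_surjective _ b
    have ha : a ∈ I.comap M.toFactor := (TwoSidedIdeal.mem_comap _).2 hb
    exact (TwoSidedIdeal.mem_bot _).2 ((hker a).2 (h ▸ ha))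

theorem corollary4p9 {K A : Type*} [Field K] [Ring A] [IsDomain A] [Algebra K A]
    (α : A ≃ₐ[K] A) (u : Subalgebra.center K A)
    (hsimple : IsSimpleRing (SkewLaurent α)) (hcentre : Algebra.IsCentral K (SkewLaurent α))
    (lam : K) (m : ℕ) (hm : 1 ≤ m)
    (hproper : Ambiskew.sumIdeal α u lam m ≠ ⊤)
    (hn : ∀ n : ℕ, 1 ≤ n → n ≠ m → Ambiskew.sumIdeal α u lam n = ⊤) :
    (IsCoatom (Ambiskew.sumIdeal α u lam m) →
      ∃! p : TwoSidedIdeal (Ambiskew.casimirIdeal α u lam).FactorRing,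
        p ≠ ⊥ ∧ p.IsPrimeIdeal) ∧
    (IsSimpleRing (Ambiskew.sumIdeal α u lam m).FactorRing →
      IsRightOreDomain (Ambiskew.sumIdeal α u lam m).FactorRing →
      ∃ P : TwoSidedIdeal (Ambiskew α (Ambiskew.split α u 1) 1),
        Ambiskew.casimirIdeal α u lam ≤ P ∧
        (∀ q : TwoSidedIdeal (Ambiskew.casimirIdeal α u lam).FactorRing,
          (q ≠ ⊥ ∧ q.IsPrimeIdeal) ↔ q = P.map (Ambiskew.casimirIdeal α u lam).toFactor) ∧
        HasRightGoldieRank P.FactorRing m) := by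
  constructor
  · intro hmax
    have := TwoSidedIdeal.isSimpleRing_factorRing hmax
    obtain ⟨φ, -, hφ⟩ := Ambiskew.exists_surjective_matrix α u lam hm hn
    exact ⟨TwoSidedIdeal.ker φ, (hφ _).2 rfl, fun q hq => (hφ q).1 hq⟩
  · intro hsimp hOre
    obtain ⟨φ, hsurj, hφ⟩ := Ambiskew.exists_surjective_matrix α u lam hm hn
    set τ := (Ambiskew.casimirIdeal α u lam).toFactor with hτ
    have hτs : Function.Surjective τ := RingCon.mk'_surjective _
    refine ⟨TwoSidedIdeal.ker (φ.comp τ), fun a ha => ?_, fun q => ?_, ?_⟩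
    · have : τ a = 0 := by
        rwa [← TwoSidedIdeal.mem_ker, TwoSidedIdeal.ker_ringCon_mk']
      rw [TwoSidedIdeal.mem_ker, RingHom.comp_apply, this, map_zero]
    · have : (TwoSidedIdeal.ker (φ.comp τ)).map τ = TwoSidedIdeal.ker φ := by
        refine le_antisymm (TwoSidedIdeal.span_le.2 ?_) fun t ht => ?_
        · rintro _ ⟨a, ha, rfl⟩
          exact (TwoSidedIdeal.mem_ker φ).2 ((TwoSidedIdeal.mem_ker (φ.comp τ)).1 ha)
        · obtain ⟨a, rfl⟩ := hτs t
          exact TwoSidedIdeal.subset_span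
            ⟨a, (TwoSidedIdeal.mem_ker (φ.comp τ)).2 ((TwoSidedIdeal.mem_ker φ).1 ht), rfl⟩
      rw [this, hφ]
    · exact hasRightGoldieRank_of_ringEquiv_matrix hOre
        (RingCon.quotientKerEquivOfSurjective (φ.comp τ) (hsurj.comp hτs))
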